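/- **Theorem.** An index is a tuple $\mathbf k=(k_1,\dots,k_r)$ of positive integers, $r\ge1$; write $|\mathbf k|=k_1+\cdots+k_r$ and $\mathbf k_+=(k_1,\dots,k_{r-1},k_r+1)$. Let $$\mathrm{Li}_{\mathbf k}(z)=\sum_{1\le m_1<\cdots<m_r}\frac{z^{m_r}}{m_1^{k_1}\cdots m_r^{k_r}}\quad(|z|<1),$$ continued holomorphically to $\mathbb C\setminus[1,\infty)$, and for $\operatorname{Re}(s)>0$ put $$\xi(\mathbf k;s)=\frac1{\Gamma(s)}\int_0^\infty t^{s-1}\frac{\mathrm{Li}_{\mathbf k}(1-e^{-t})}{e^t-1}\,dt,\qquad \eta(\mathbf k;s)=\frac1{\Gamma(s)}\int_0^\infty t^{s-1}\frac{\mathrm{Li}_{\mathbf k}(1-e^{t})}{1-e^t}\,dt .$$ For $l_1,\dots,l_n\ge1$ with $l_n\ge2$ let $$\zeta(l_1,\dots,l_n)=\sum_{1\le m_1<\cdots<m_n}\frac1{m_1^{l_1}\cdots m_n^{l_n}},\qquad \zeta^\star(l_1,\dots,l_n)=\sum_{1\le m_1\le\cdots\le m_n}\frac1{m_1^{l_1}\cdots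 m_n^{l_n}} .$$ An index whose last entry is at least $2$ can be written uniquely as $(\{1\}^{a_1-1},b_1+1,\dots,\{1\}^{a_h-1},b_h+1)$ with $h\ge 1$ and all $a_i,b_i\ge1$, where $\{1\}^{a}$ stands for $a$ entries equal to $1$; its dual index is $(\{1\}^{b_h-1},a_h+1,\dots,\{1\}^{b_1-1},a_1+1)$, and $\mathbf l^*$ denotes the dual of $\mathbf l$. For $\mathbf l\in\mathbb Z_{\ge1}^n$ and $\mathbf j\in\mathbb Z_{\ge0}^n$ let $b(\mathbf l;\mathbf j)=\prod_{i=1}^n\binom{l_i+j_i-1}{j_i}$, and let $\mathbf l+\mathbf j$ be the componentwise sum. Let $\mathbf k\in\mathbb Z_{\ge1}^r$ and $m\in\mathbb Z_{\ge1}$. Then $(\mathbf k_+)^*$ has $n=|\mathbf k|+1-r$ entries, all integrals and series below converge absolutely, and $$\xi(\mathbf k;m)=\sum_{\mathbf j\in\mathbb Z_{\ge0}^n,\ |\mathbf j|=m-1} b((\mathbf k_+)^*;\mathbf j)\,\zeta((\mathbf k_+)^*+\mathbf j),$$ $$\eta(\mathbf k;m)=(-1)^{r-1}\sum_{\mathbf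 j\in\mathbb Z_{\ge0}^n,\ |\mathbf j|=m-1} b((\mathbf k_+)^*;\mathbf j)\,\zeta^\star((\mathbf k_+)^*+\mathbf j).$$ In particular $\xi(\mathbf k;1)=\zeta((\mathbf k_+)^*)=\zeta(\mathbf k_+)$ and $\eta(\mathbf k;1)=(-1)^{r-1}\zeta^\star((\mathbf k_+)^*)$. -/

import Mathlib

/-- The slit plane `ℂ ∖ [1, ∞)`. -/
def polylogDomain : Set ℂ := {z | ¬ (1 ≤ z.re ∧ z.im = 0)}

/-- The summation tuples `1 ≤ m₁ < ⋯ < m_r`. -/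
abbrev StrictTuple (r : ℕ) : Type := {m : Fin r → ℕ // StrictMono m ∧ ∀ i, 1 ≤ m i}

/-- The summation tuples `1 ≤ m₁ ≤ ⋯ ≤ m_r`. -/
abbrev WeakTuple (r : ℕ) : Type := {m : Fin r → ℕ // Monotone m ∧ ∀ i, 1 ≤ m i}

/-- The term `z ^ m_r / (m₁ ^ k₁ ⋯ m_r ^ k_r)` of the multiple polylogarithm series.
As `m` is increasing, its last entry `m_r` is its maximum. -/
noncomputable def polylogTerm {r : ℕ} (k : Fin r → ℕ) (z : ℂ) (m : StrictTuple r) : ℂ :=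
  z ^ (Finset.univ.sup m.1) / ∏ i, (m.1 i : ℂ) ^ k i

theorem polylogDomain_iff (z : ℂ) : z ∈ polylogDomain ↔ 1 - z ∈ Complex.slitPlane := by
  simp only [polylogDomain, Set.mem_ofPred_eq, Complex.mem_slitPlane_iff, Complex.sub_re,
    Complex.one_re, Complex.sub_im, Complex.one_im, sub_pos, zero_sub, neg_ne_zero]
  rw [not_and_or, not_le]

theorem polylogDomain_isOpen : IsOpen polylogDomain := by
  have : polylogDomain = (fun z : ℂ => 1 - z) ⁻¹' Complex.slitPlane := by
    ext z; exact polylogDomain_iff z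
  rw [this]
  exact Complex.isOpen_slitPlane.preimage (by fun_prop)

theorem mem_polylogDomain_of_norm_lt {z : ℂ} (hz : ‖z‖ < 1) : z ∈ polylogDomain := by
  rintro ⟨h, -⟩
  have := (Complex.re_le_norm z)
  linarith

theorem exists_primitive_polylogDomain {g : ℂ → ℂ} (hg : DifferentiableOn ℂ g polylogDomain) :
    ∃ F : ℂ → ℂ, F 0 = 0 ∧ ∀ z ∈ polylogDomain, HasDerivAt F (g z) z := by
  have hopen : IsOpen {s : ℂ | 0 < s.re} := isOpen_lt continuous_const Complex.continuous_re
  have hconv : Convex ℝ {s : ℂ | 0 < s.re} := convex_halfSpace_re_gt 0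
  have hmap : ∀ s : ℂ, 0 < s.re → 1 - s ^ 2 ∈ polylogDomain := by
    intro s hs
    rw [polylogDomain_iff, sub_sub_cancel, Complex.mem_slitPlane_iff, pow_two, Complex.mul_re,
      Complex.mul_im]
    by_cases h : s.im = 0
    · left; rw [h]; nlinarith
    · right
      have : s.re * s.im + s.im * s.re = 2 * (s.re * s.im) := by ring
      rw [this]
      exact mul_ne_zero two_ne_zero (mul_ne_zero hs.ne' h)
  have hd : DifferentiableOn ℂ (fun s : ℂ => g (1 - s ^ 2) * (-(2 * s))) {s : ℂ | 0 < s.re} := by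
    refine DifferentiableOn.mul ?_ (by fun_prop)
    exact hg.comp (by fun_prop) (fun s hs => hmap s hs)
  obtain ⟨G, hG⟩ := hconv.exists_forall_hasDerivWithinAt hd
  have key : ∀ z ∈ polylogDomain,
      HasDerivAt (fun z : ℂ => G ((1 - z) ^ (1 / 2 : ℂ))) (g z) z := by
    intro z hz
    rw [polylogDomain_iff] at hz
    have hne : (1 - z) ≠ 0 := Complex.slitPlane_ne_zero hz
    set s : ℂ := (1 - z) ^ (1 / 2 : ℂ) with hs
    have hsq : s ^ 2 = 1 - z := by
      rw [hs, ← Complex.cpow_nat_mul]; norm_num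
    have hsre : 0 < s.re := by
      rw [hs, Complex.cpow_def_of_ne_zero hne, Complex.exp_re]
      refine mul_pos (Real.exp_pos _) (Real.cos_pos_of_mem_Ioo ?_)
      have him : (Complex.log (1 - z) * (1 / 2)).im = (1 - z).arg / 2 := by
        rw [show (1 / 2 : ℂ) = ((1 / 2 : ℝ) : ℂ) by norm_num, Complex.im_mul_ofReal,
          Complex.log_im]; ring
      rw [him]
      have h1 := Complex.neg_pi_lt_arg (1 - z)
      have h2 := Complex.arg_le_pi (1 - z)
      have h3 := (Complex.mem_slitPlane_iff_arg.1 hz).1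
      have h4 := lt_of_le_of_ne h2 h3
      constructor <;> linarith
    have hsne : s ≠ 0 := by
      intro h; rw [h] at hsre; simp at hsre
    have h1 : HasDerivAt G (g (1 - s ^ 2) * (-(2 * s))) s :=
      (hG s hsre).hasDerivAt (hopen.mem_nhds hsre)
    have h2 : HasDerivAt (fun z : ℂ => (1 - z) ^ (1 / 2 : ℂ))
        ((1 / 2 : ℂ) * (1 - z) ^ ((1 / 2 : ℂ) - 1) * (-1)) z :=
      ((hasDerivAt_id z).const_sub 1).cpow_const hz
    have h3 := HasDerivAt.comp z h1 h2
    convert! h3 using 1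
    rw [hsq, sub_sub_cancel, Complex.cpow_sub _ _ hne, Complex.cpow_one, ← hs, ← hsq]
    field_simp
  refine ⟨fun z => G ((1 - z) ^ (1 / 2 : ℂ)) - G ((1 - 0) ^ (1 / 2 : ℂ)), by simp, ?_⟩
  intro z hz
  exact (key z hz).sub_const _

theorem exists_polylog_raise {ι : Type} (c : ι → ℂ) (n : ι → ℕ) (hn : ∀ i, 1 ≤ n i) {f : ℂ → ℂ}
    (hf : DifferentiableOn ℂ f polylogDomain)
    (hs : ∀ z : ℂ, ‖z‖ < 1 → HasSum (fun i => c i * z ^ n i) (f z)) :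
    ∃ F : ℂ → ℂ, DifferentiableOn ℂ F polylogDomain ∧
      ∀ z : ℂ, ‖z‖ < 1 → HasSum (fun i => c i / n i * z ^ n i) (F z) := by
  have h0 : (0 : ℂ) ∈ polylogDomain := mem_polylogDomain_of_norm_lt (by simp)
  have hf0 : f 0 = 0 := by
    refine (hs 0 (by simp)).unique ?_
    convert! hasSum_zero with i
    rw [zero_pow (by have := hn i; omega), mul_zero]
  have hg : DifferentiableOn ℂ (dslope f 0) polylogDomain :=
    (Complex.differentiableOn_dslope (polylogDomain_isOpen.mem_nhds h0)).2 hf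
  obtain ⟨F, hF0, hF⟩ := exists_primitive_polylogDomain hg
  refine ⟨F, fun z hz => (hF z hz).differentiableAt.differentiableWithinAt, ?_⟩
  intro z hz
  obtain ⟨ρ, hρz, hρ1⟩ := exists_between hz
  have hρ0 : 0 < ρ := lt_of_le_of_lt (norm_nonneg _) hρz
  have hball : ∀ w ∈ Metric.ball (0 : ℂ) ρ, ‖w‖ < 1 := fun w hw =>
    (mem_ball_zero_iff.1 hw).trans hρ1
  have hsumm : ∀ w : ℂ, ‖w‖ < 1 → Summable (fun i => c i / n i * w ^ n i) := by
    intro w hw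
    refine Summable.of_norm_bounded (hs w hw).summable.norm ?_
    intro i
    rw [norm_mul, norm_mul, norm_div, Complex.norm_natCast]
    gcongr
    refine div_le_self (norm_nonneg _) ?_
    exact_mod_cast hn i
  set S : ℂ → ℂ := fun w => ∑' i, c i / n i * w ^ n i with hS
  have hu : Summable (fun i => ‖c i‖ * ρ ^ (n i - 1)) := by
    have h1 := ((hs (ρ : ℂ) (by simpa [abs_of_pos hρ0] using hρ1)).summable.norm).mul_right ρ⁻¹
    convert! h1 using 2 with i
    rw [norm_mul, norm_pow, Complex.norm_real, Real.norm_of_nonneg hρ0.le, mul_assoc]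
    congr 1
    obtain ⟨j, hj⟩ : ∃ j, n i = j + 1 := ⟨n i - 1, by have := hn i; omega⟩
    rw [hj, Nat.add_sub_cancel, pow_succ, mul_assoc, mul_inv_cancel₀ hρ0.ne', mul_one]
  have hSd : ∀ w ∈ Metric.ball (0 : ℂ) ρ,
      HasDerivAt S (∑' i, c i * w ^ (n i - 1)) w := by
    intro w hw
    refine hasDerivAt_tsum_of_isPreconnected hu Metric.isOpen_ball
      (convex_ball (0 : ℂ) ρ).isPreconnected (g := fun i w => c i / n i * w ^ n i)
      (g' := fun i w => c i * w ^ (n i - 1)) ?_ ?_ (Metric.mem_ball_self hρ0)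
      (hsumm 0 (by simp)) hw
    · intro i y _
      have := (hasDerivAt_pow (n i) y).const_mul (c i / n i)
      convert! this using 1
      have : (n i : ℂ) ≠ 0 := by
        have := hn i
        exact_mod_cast (by omega : n i ≠ 0)
      field_simp
    · intro i y hy
      rw [norm_mul, norm_pow]
      gcongr
      exact (mem_ball_zero_iff.1 hy).le
  have hSdiff : DifferentiableOn ℂ S (Metric.ball 0 ρ) := fun w hw =>
    (hSd w hw).differentiableAt.differentiableWithinAt
  have hmul : ∀ w ∈ Metric.ball (0 : ℂ) ρ, f w = w * deriv S w := by
    intro w hw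
    rw [(hSd w hw).deriv, ← tsum_mul_left, ← (hs w (hball w hw)).tsum_eq]
    refine tsum_congr fun i => ?_
    obtain ⟨j, hj⟩ : ∃ j, n i = j + 1 := ⟨n i - 1, by have := hn i; omega⟩
    rw [hj, Nat.add_sub_cancel, pow_succ]; ring
  have hderiv : ∀ w ∈ Metric.ball (0 : ℂ) ρ, deriv S w = dslope f 0 w := by
    intro w hw
    rcases eq_or_ne w 0 with rfl | hw0
    · rw [dslope_same]
      have hev : f =ᶠ[nhds 0] fun w => w * deriv S w := by
        filter_upwards [Metric.isOpen_ball.mem_nhds hw] with w hw using hmul w hw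
      rw [hev.deriv_eq]
      have hd := ((hSdiff.deriv Metric.isOpen_ball).differentiableAt
        (Metric.isOpen_ball.mem_nhds hw)).hasDerivAt
      have := ((hasDerivAt_id (0 : ℂ)).mul hd).deriv
      simp only [id, one_mul, zero_mul, add_zero] at this
      exact this.symm
    · rw [dslope_of_ne _ hw0, slope_def_field, hf0, hmul w hw]
      field_simp
      simp
  have hEq : Set.EqOn S F (Metric.ball 0 ρ) := by
    refine Metric.isOpen_ball.eqOn_of_deriv_eq (convex_ball (0 : ℂ) ρ).isPreconnected hSdiff
      ?_ ?_ (Metric.mem_ball_self hρ0) ?_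
    · intro w hw
      exact (hF w (mem_polylogDomain_of_norm_lt
        (hball w hw))).differentiableAt.differentiableWithinAt
    · intro w hw
      rw [hderiv w hw, (hF w (mem_polylogDomain_of_norm_lt (hball w hw))).deriv]
    · rw [hF0, hS]
      show ∑' i, c i / n i * (0 : ℂ) ^ n i = 0
      convert! tsum_zero with i
      rw [zero_pow (by have := hn i; omega), mul_zero]
  rw [← hEq (mem_ball_zero_iff.2 hρz)]
  exact (hsumm z hz).hasSum

/-- Tuples of length `r + 1` correspond to a tuple of length `r` and the gap before the new last
entry. -/
def strictTupleEquiv (r : ℕ) : StrictTuple r × ℕ ≃ StrictTuple (r + 1) where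
  toFun p := ⟨Fin.snoc (α := fun _ => ℕ) p.1.1 (Finset.univ.sup p.1.1 + p.2 + 1), by
    have hle : ∀ i, p.1.1 i ≤ Finset.univ.sup p.1.1 := fun i =>
      Finset.le_sup (f := p.1.1) (Finset.mem_univ i)
    constructor
    · intro i j hij
      induction j using Fin.lastCases with
      | last =>
        induction i using Fin.lastCases with
        | last => exact absurd hij (lt_irrefl _)
        | cast i => simp only [Fin.snoc_castSucc, Fin.snoc_last]; have := hle i; omega
      | cast j =>
        induction i using Fin.lastCases with
        | last => exact absurd hij (not_lt.2 (Fin.le_last _))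
        | cast i =>
          simp only [Fin.snoc_castSucc]
          exact p.1.2.1 (Fin.castSucc_lt_castSucc_iff.1 hij)
    · intro i
      induction i using Fin.lastCases with
      | last => simp
      | cast i => simpa using p.1.2.2 i⟩
  invFun m := (⟨fun i => m.1 i.castSucc, fun _ _ h => m.2.1 (Fin.castSucc_lt_castSucc_iff.2 h),
      fun i => m.2.2 _⟩,
    m.1 (Fin.last r) - (Finset.univ.sup fun i : Fin r => m.1 i.castSucc) - 1)
  left_inv p := by
    refine Prod.ext (Subtype.ext ?_) ?_
    · funext i; simp
    · simp only [Fin.snoc_castSucc, Fin.snoc_last]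
      have : (Finset.univ.sup fun i => p.1.1 i) = Finset.univ.sup p.1.1 := rfl
      omega
  right_inv m := by
    refine Subtype.ext ?_
    funext i
    induction i using Fin.lastCases with
    | last =>
      have h1 : (Finset.univ.sup fun i : Fin r => m.1 i.castSucc) < m.1 (Fin.last r) := by
        rw [Finset.sup_lt_iff (by have := m.2.2 (Fin.last r); simp; omega)]
        intro i _
        exact m.2.1 (Fin.castSucc_lt_last i)
      simp only [Fin.snoc_last]; omega
    | cast i => simp

theorem sup_strictTupleEquiv {r : ℕ} (p : StrictTuple r × ℕ) :
    Finset.univ.sup (strictTupleEquiv r p).1 = Finset.univ.sup p.1.1 + p.2 + 1 := by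
  refine le_antisymm (Finset.sup_le fun i _ => ?_) ?_
  · induction i using Fin.lastCases with
    | last => simp [strictTupleEquiv]
    | cast i =>
      have := Finset.le_sup (f := p.1.1) (Finset.mem_univ i)
      simp only [strictTupleEquiv, Equiv.coe_fn_mk, Fin.snoc_castSucc]
      omega
  · have := Finset.le_sup (f := (strictTupleEquiv r p).1) (Finset.mem_univ (Fin.last r))
    simpa [strictTupleEquiv] using this

theorem sup_strictTuple_eq_last {r : ℕ} (m : StrictTuple (r + 1)) :
    Finset.univ.sup m.1 = m.1 (Fin.last r) :=
  le_antisymm (Finset.sup_le fun i _ => m.2.1.monotone (Fin.le_last i))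
    (Finset.le_sup (f := m.1) (Finset.mem_univ _))

/-- The multiple polylogarithm series converges absolutely in the open unit disc, and its sum has
an analytic continuation to `ℂ ∖ [1, ∞)`. -/
theorem exists_multiPolylog : ∀ {r : ℕ} (k : Fin r → ℕ), ∃ f : ℂ → ℂ,
    DifferentiableOn ℂ f polylogDomain ∧
      ∀ z : ℂ, ‖z‖ < 1 → HasSum (polylogTerm k z) (f z) := by
  intro r
  induction r with
  | zero =>
    intro k
    refine ⟨fun _ => 1, differentiableOn_const _, fun z _ => ?_⟩
    let m₀ : StrictTuple 0 := ⟨Fin.elim0, fun i => i.elim0, fun i => i.elim0⟩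
    have hsub : ∀ m : StrictTuple 0, m = m₀ := fun m => Subtype.ext (Subsingleton.elim _ _)
    have := hasSum_single (f := polylogTerm k z) m₀ (fun m hm => absurd (hsub m) hm)
    simpa [polylogTerm] using this
  | succ r ih =>
    intro k
    obtain ⟨k', a, rfl⟩ : ∃ (k' : Fin r → ℕ) (a : ℕ), k = Fin.snoc (α := fun _ => ℕ) k' a :=
      ⟨fun i => k i.castSucc, k (Fin.last r), by
        funext i; induction i using Fin.lastCases <;> simp⟩
    induction a with
    | zero =>
      obtain ⟨f, hf, hs⟩ := ih k'
      refine ⟨fun z => f z * (z * (1 - z)⁻¹), ?_, ?_⟩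
      · refine hf.mul (differentiableOn_id.mul (DifferentiableOn.inv (by fun_prop) ?_))
        intro z hz
        exact Complex.slitPlane_ne_zero ((polylogDomain_iff z).1 hz)
      · intro z hz
        have hgeo : HasSum (fun d : ℕ => z * z ^ d) (z * (1 - z)⁻¹) :=
          (hasSum_geometric_of_norm_lt_one hz).mul_left z
        have hprod : Summable fun p : StrictTuple r × ℕ =>
            polylogTerm k' z p.1 * (z * z ^ p.2) :=
          summable_mul_of_summable_norm (f := polylogTerm k' z) (g := fun d : ℕ => z * z ^ d) (hs z hz).summable.norm hgeo.summable.norm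
        have hmul := (hs z hz).mul hgeo hprod
        have hfun : polylogTerm (Fin.snoc (α := fun _ => ℕ) k' 0) z ∘ strictTupleEquiv r =
            fun p : StrictTuple r × ℕ => polylogTerm k' z p.1 * (z * z ^ p.2) := by
          funext p
          simp only [Function.comp, polylogTerm]
          rw [sup_strictTupleEquiv, Fin.prod_univ_castSucc]
          simp only [strictTupleEquiv, Equiv.coe_fn_mk, Fin.snoc_castSucc, Fin.snoc_last, pow_zero,
            mul_one]
          rw [pow_add, pow_add, pow_one]
          ring
        rw [← (strictTupleEquiv r).hasSum_iff, hfun]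
        exact hmul
    | succ a iha =>
      obtain ⟨f, hf, hs⟩ := iha
      obtain ⟨F, hF, hFs⟩ := exists_polylog_raise
        (fun m : StrictTuple (r + 1) =>
          (∏ i, (m.1 i : ℂ) ^ (Fin.snoc (α := fun _ => ℕ) k' a : Fin (r + 1) → ℕ) i)⁻¹)
        (fun m => Finset.univ.sup m.1)
        (fun m => (m.2.2 (Fin.last r)).trans (Finset.le_sup (f := m.1) (Finset.mem_univ _))) hf
        (fun z hz => by
          have hfun : polylogTerm (Fin.snoc (α := fun _ => ℕ) k' a) z =
              fun m : StrictTuple (r + 1) =>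
                (∏ i, (m.1 i : ℂ) ^ (Fin.snoc (α := fun _ => ℕ) k' a : Fin (r + 1) → ℕ) i)⁻¹ *
                  z ^ Finset.univ.sup m.1 := by
            funext m
            rw [polylogTerm, div_eq_mul_inv, mul_comm]
          rw [← hfun]
          exact hs z hz)
      refine ⟨F, hF, fun z hz => ?_⟩
      have hfun : polylogTerm (Fin.snoc (α := fun _ => ℕ) k' (a + 1)) z =
          fun m : StrictTuple (r + 1) =>
            (∏ i, (m.1 i : ℂ) ^ (Fin.snoc (α := fun _ => ℕ) k' a : Fin (r + 1) → ℕ) i)⁻¹ /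
              (Finset.univ.sup m.1 : ℕ) * z ^ Finset.univ.sup m.1 := by
        funext m
        rw [polylogTerm, Fin.prod_univ_castSucc, Fin.prod_univ_castSucc, sup_strictTuple_eq_last]
        simp only [Fin.snoc_castSucc, Fin.snoc_last]
        rw [pow_succ, div_eq_mul_inv, div_eq_mul_inv, mul_inv, mul_inv, mul_inv]
        ring
      rw [hfun]
      exact hFs z hz

/-- The multiple polylogarithm `Li_{k₁,…,k_r}` on `ℂ ∖ [1, ∞)`: the holomorphic function on this
slit plane (unique, as the slit plane is connected) that is given on the open unit disc by
`∑_{1 ≤ m₁ < ⋯ < m_r} z ^ m_r / (m₁ ^ k₁ ⋯ m_r ^ k_r)`. -/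
noncomputable def multiPolylog {r : ℕ} (k : Fin r → ℕ) : ℂ → ℂ :=
  Classical.choose (exists_multiPolylog k)

theorem multiPolylog_differentiableOn {r : ℕ} (k : Fin r → ℕ) :
    DifferentiableOn ℂ (multiPolylog k) polylogDomain :=
  (Classical.choose_spec (exists_multiPolylog k)).1

theorem multiPolylog_hasSum {r : ℕ} (k : Fin r → ℕ) {z : ℂ} (hz : ‖z‖ < 1) :
    HasSum (polylogTerm k z) (multiPolylog k z) :=
  (Classical.choose_spec (exists_multiPolylog k)).2 z hz

/-- The integrand `t ^ (s - 1) Li_k(1 - e ^ (-t)) / (e ^ t - 1)` of the function `ξ(k; s)`. -/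
noncomputable def xiIntegrand {r : ℕ} (k : Fin r → ℕ) (s : ℂ) (t : ℝ) : ℂ :=
  (t : ℂ) ^ (s - 1) * (multiPolylog k (1 - Complex.exp (-t)) / (Complex.exp t - 1))

/-- The integrand `t ^ (s - 1) Li_k(1 - e ^ t) / (1 - e ^ t)` of the function `η(k; s)`. -/
noncomputable def etaIntegrand {r : ℕ} (k : Fin r → ℕ) (s : ℂ) (t : ℝ) : ℂ :=
  (t : ℂ) ^ (s - 1) * (multiPolylog k (1 - Complex.exp t) / (1 - Complex.exp t))

/-- The function `ξ(k; s)`, in the region where its defining integral converges. -/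
noncomputable def arakawaKanekoXi {r : ℕ} (k : Fin r → ℕ) (s : ℂ) : ℂ :=
  1 / Complex.Gamma s * ∫ t in Set.Ioi (0 : ℝ), xiIntegrand k s t

/-- The function `η(k; s)`, in the region where its defining integral converges. -/
noncomputable def kanekoTsumuraEta {r : ℕ} (k : Fin r → ℕ) (s : ℂ) : ℂ :=
  1 / Complex.Gamma s * ∫ t in Set.Ioi (0 : ℝ), etaIntegrand k s t

/-- The term `1 / (m₁ ^ l₁ ⋯ m_n ^ l_n)`. -/
noncomputable def zetaTerm {n : ℕ} (l : Fin n → ℕ) (m : Fin n → ℕ) : ℝ :=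
  1 / ∏ i, (m i : ℝ) ^ l i

/-- The multiple zeta value `∑_{1 ≤ m₁ < ⋯ < m_n} 1 / (m₁ ^ l₁ ⋯ m_n ^ l_n)`. -/
noncomputable def multiZeta {n : ℕ} (l : Fin n → ℕ) : ℝ :=
  ∑' m : StrictTuple n, zetaTerm l m.1

/-- The multiple zeta-star value `∑_{1 ≤ m₁ ≤ ⋯ ≤ m_n} 1 / (m₁ ^ l₁ ⋯ m_n ^ l_n)`. -/
noncomputable def multiZetaStar {n : ℕ} (l : Fin n → ℕ) : ℝ :=
  ∑' m : WeakTuple n, zetaTerm l m.1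

/-- `k₊ = (k₁, …, k_{r-1}, k_r + 1)`. -/
def raiseLast {r : ℕ} (k : Fin r → ℕ) : Fin r → ℕ :=
  fun i => if (i : ℕ) + 1 = r then k i + 1 else k i

/-- The word `1 0^{k₁-1} 1 0^{k₂-1} ⋯ 1 0^{k_r-1}` of an index (`true` stands for `1`). -/
def indexToWord (k : List ℕ) : List Bool :=
  k.flatMap fun a => true :: List.replicate (a - 1) false

/-- Reads a word as an index, where `c` is the value reached so far by the current entry. -/
def wordToIndexFrom : ℕ → List Bool → List ℕ
  | c, [] => [c]
  | c, true :: w => c :: wordToIndexFrom 1 w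
  | c, false :: w => wordToIndexFrom (c + 1) w

/-- The index of a word that begins with `1` (the inverse of `indexToWord`). -/
def wordToIndex : List Bool → List ℕ
  | true :: w => wordToIndexFrom 1 w
  | _ => []

/-- The usual dual of an admissible index: reverse the word and exchange `0` and `1`. Thus
`({1}^{a₁-1}, b₁+1, …, {1}^{a_h-1}, b_h+1)` has the dual
`({1}^{b_h-1}, a_h+1, …, {1}^{b₁-1}, a₁+1)`. -/
def dualList (k : List ℕ) : List ℕ :=
  wordToIndex ((indexToWord k).reverse.map not)

/-- The depth of the dual index. -/
def dualDepth {r : ℕ} (k : Fin r → ℕ) : ℕ := (dualList (List.ofFn k)).length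

/-- The dual index `k*`, as a tuple. -/
def dualIndex {r : ℕ} (k : Fin r → ℕ) : Fin (dualDepth k) → ℕ :=
  (dualList (List.ofFn k)).get

/-- `b(k; j) = ∏ᵢ binom(kᵢ + jᵢ - 1, jᵢ)`. -/
def indexBinom {n : ℕ} (k j : Fin n → ℕ) : ℕ := ∏ i, (k i + j i - 1).choose (j i)

/-! Substitute `z = 1 - e^{-σt}` with `σ = 1` for ξ and `σ = -1` for η. The form `dz/(1-z)` becomes
`σ dt`, and `dz/z` becomes `bernoulliKernel δ t dt`, with `δ = 1` or `0` respectively. The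
differential equations of the polylogarithm then make `Li_k(1 - e^{-σt})` equal to `σ^r` times an
iterated integral of nonnegative functions, whose letters spell the dual word of `k`
(`multiPolylog_eq_headIntegral`). The factor `1/(e^t-1)` in front supplies one more letter `true`,
which turns the dual word of `k` into that of `k₊`.

Now integrate from the largest variable inwards, starting from `t^q/q!` with `q = m - 1`. Each
kernel is expanded as a geometric series, so only densities `t^i/i! * e^{-Mt}` occur. Integrating
such a density over `(u, ∞)` is, on generating series in `X` over `i`, multiplication by `1/(M -
X)`; multiplying by a kernel replaces `M` by every `M + δ + l` with `l ≥ 0`. Reading the word letter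
by letter thus builds `∑ ∏ (mᵢ - X)^{-lᵢ}`, where `l` is the dual index and `mᵢ + δ ≤ mᵢ₊₁`: strict
chains for ξ, weak ones for η. The coefficient of `X^q` gives the binomials and the zeta values
(`lintegral_erlangDensity_mul_headIntegral`, `indexSeriesAt_wordToIndexFrom`, `coeff_indexSeries`).

Everything takes place in `ℝ≥0∞`, so Tonelli applies freely. One crude bound makes the integral
finite (`zetaIntegral_ne_top`), and convergence of all the series follows from it. Duality comes
from computing the integral of ξ at `m = 1` a second time, by integrating the power series of `Li_k`
termwise (`zetaIntegral_one_zero`). -/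

/-! ### Analytic continuation and the differential equations of the polylogarithms. -/

theorem isPreconnected_polylogDomain : IsPreconnected polylogDomain := by
  have hstar : StarConvex ℝ (0 : ℂ) polylogDomain := by
    rw [starConvex_zero_iff]
    rintro z hz a ha0 ha1 ⟨h1, h2⟩
    rw [Complex.smul_re, smul_eq_mul] at h1
    rw [Complex.smul_im, smul_eq_mul] at h2
    have hpos : 0 < a := by
      rcases ha0.eq_or_lt with h | h
      · rw [← h] at h1; norm_num at h1
      · exact h
    refine hz ⟨?_, (mul_eq_zero.1 h2).resolve_left hpos.ne'⟩
    nlinarith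
  exact (hstar.isPathConnected (mem_polylogDomain_of_norm_lt (by simp))).isConnected.isPreconnected

/-- Identity theorem: relations between polylogarithms need checking only on power series. -/
theorem eqOn_polylogDomain {f g : ℂ → ℂ} (hf : DifferentiableOn ℂ f polylogDomain)
    (hg : DifferentiableOn ℂ g polylogDomain) (h : ∀ z : ℂ, ‖z‖ < 1 → f z = g z) :
    Set.EqOn f g polylogDomain := by
  refine (hf.analyticOnNhd polylogDomain_isOpen).eqOn_of_preconnected_of_eventuallyEq
    (hg.analyticOnNhd polylogDomain_isOpen) isPreconnected_polylogDomain
    (z₀ := 0) (mem_polylogDomain_of_norm_lt (by simp)) ?_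
  filter_upwards [Metric.ball_mem_nhds (0 : ℂ) one_pos] with z hz
  exact h z (mem_ball_zero_iff.1 hz)

/-- The Euler operator `z d/dz` acts on a power series termwise, and this persists under analytic
continuation to the slit plane. -/
theorem mul_deriv_eq_of_hasSum {ι : Type} (c : ι → ℂ) (n : ι → ℕ) {F f : ℂ → ℂ}
    (hF : DifferentiableOn ℂ F polylogDomain) (hf : DifferentiableOn ℂ f polylogDomain)
    (hFs : ∀ z : ℂ, ‖z‖ < 1 → HasSum (fun i => c i * z ^ n i) (F z))
    (hfs : ∀ z : ℂ, ‖z‖ < 1 → HasSum (fun i => n i * c i * z ^ n i) (f z)) :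
    ∀ z ∈ polylogDomain, z * deriv F z = f z := by
  refine eqOn_polylogDomain (differentiableOn_id.mul (hF.deriv polylogDomain_isOpen)) hf ?_
  intro z hz
  obtain ⟨ρ, hρz, hρ1⟩ := exists_between hz
  have hρ0 : 0 < ρ := lt_of_le_of_lt (norm_nonneg _) hρz
  have hball : ∀ w ∈ Metric.ball (0 : ℂ) ρ, ‖w‖ < 1 := fun w hw =>
    (mem_ball_zero_iff.1 hw).trans hρ1
  have hu : Summable (fun i => ‖(n i : ℂ) * c i‖ * ρ ^ (n i - 1)) := by
    have h1 := ((hfs (ρ : ℂ) (by simpa [abs_of_pos hρ0] using hρ1)).summable.norm).mul_right ρ⁻¹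
    convert! h1 using 2 with i
    rw [norm_mul _ ((ρ : ℂ) ^ _), norm_pow, Complex.norm_real, Real.norm_of_nonneg hρ0.le,
      mul_assoc]
    -- For exponent 0 the truncated `n i - 1` is wrong, but the factor `n i` kills the term.
    rcases Nat.eq_zero_or_pos (n i) with h | h
    · simp [h]
    · congr 1
      obtain ⟨j, hj⟩ : ∃ j, n i = j + 1 := ⟨n i - 1, by omega⟩
      rw [hj, Nat.add_sub_cancel, pow_succ, mul_assoc, mul_inv_cancel₀ hρ0.ne', mul_one]
  have hd : HasDerivAt (fun w => ∑' i, c i * w ^ n i)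
      (∑' i, (n i : ℂ) * c i * z ^ (n i - 1)) z := by
    refine hasDerivAt_tsum_of_isPreconnected hu Metric.isOpen_ball
      (convex_ball (0 : ℂ) ρ).isPreconnected (g := fun i w => c i * w ^ n i)
      (g' := fun i w => (n i : ℂ) * c i * w ^ (n i - 1)) ?_ ?_ (Metric.mem_ball_self hρ0)
      (hFs 0 (by simp)).summable (mem_ball_zero_iff.2 hρz)
    · intro i y _
      have := (hasDerivAt_pow (n i) y).const_mul (c i)
      convert! this using 1
      ring
    · intro i y hy
      rw [norm_mul _ (y ^ _), norm_pow]
      gcongr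
      exact (mem_ball_zero_iff.1 hy).le
  have hev : F =ᶠ[nhds z] fun w => ∑' i, c i * w ^ n i := by
    filter_upwards [Metric.isOpen_ball.mem_nhds (mem_ball_zero_iff.2 hρz)] with w hw
    exact (hFs w (hball w hw)).tsum_eq.symm
  change z * deriv F z = f z
  rw [hev.deriv_eq, hd.deriv, ← tsum_mul_left, ← (hfs z hz).tsum_eq]
  refine tsum_congr fun i => ?_
  rcases Nat.eq_zero_or_pos (n i) with h | h
  · simp [h]
  · obtain ⟨j, hj⟩ : ∃ j, n i = j + 1 := ⟨n i - 1, by omega⟩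
    rw [hj, Nat.add_sub_cancel, pow_succ]; ring

theorem mul_deriv_multiPolylog {r : ℕ} (k : Fin r → ℕ) (a : ℕ) :
    ∀ z ∈ polylogDomain,
      z * deriv (multiPolylog (Fin.snoc (α := fun _ => ℕ) k (a + 1) : Fin (r + 1) → ℕ)) z =
        multiPolylog (Fin.snoc (α := fun _ => ℕ) k a : Fin (r + 1) → ℕ) z := by
  have hterm : ∀ (k : Fin (r + 1) → ℕ) (z : ℂ) (m : StrictTuple (r + 1)),
      polylogTerm k z m = (∏ i, (m.1 i : ℂ) ^ k i)⁻¹ * z ^ Finset.univ.sup m.1 := by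
    intro k z m
    rw [polylogTerm, div_eq_mul_inv, mul_comm]
  refine mul_deriv_eq_of_hasSum (fun m : StrictTuple (r + 1) =>
      (∏ i, (m.1 i : ℂ) ^ (Fin.snoc (α := fun _ => ℕ) k (a + 1) : Fin (r + 1) → ℕ) i)⁻¹)
    (fun m => Finset.univ.sup m.1) (multiPolylog_differentiableOn _)
    (multiPolylog_differentiableOn _) (fun z hz => ?_) (fun z hz => ?_)
  · convert! multiPolylog_hasSum _ hz using 2 with m
    exact (hterm _ _ _).symm
  · convert! multiPolylog_hasSum _ hz using 2 with m
    rw [hterm, sup_strictTuple_eq_last, Fin.prod_univ_castSucc, Fin.prod_univ_castSucc]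
    simp only [Fin.snoc_castSucc, Fin.snoc_last]
    have hne : (m.1 (Fin.last r) : ℂ) ≠ 0 := by
      have := m.2.2 (Fin.last r)
      exact_mod_cast (by omega : m.1 (Fin.last r) ≠ 0)
    rw [pow_succ, mul_inv, mul_inv, mul_inv]
    field_simp

/-- With last exponent 0 the last variable runs freely above the previous one, which is a geometric
series in the gap. Admitting the entry 0 lets the Euler operator lower the last entry uniformly, and
the depth drops only here. -/
theorem multiPolylog_snoc_zero {r : ℕ} (k : Fin r → ℕ) :
    ∀ z ∈ polylogDomain,
      multiPolylog (Fin.snoc (α := fun _ => ℕ) k 0 : Fin (r + 1) → ℕ) z =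
        multiPolylog k z * (z * (1 - z)⁻¹) := by
  refine eqOn_polylogDomain (multiPolylog_differentiableOn _)
    ((multiPolylog_differentiableOn k).mul
      (differentiableOn_id.mul (DifferentiableOn.inv (by fun_prop) ?_))) ?_
  · intro z hz
    exact Complex.slitPlane_ne_zero ((polylogDomain_iff z).1 hz)
  · intro z hz
    have hs := multiPolylog_hasSum k hz
    have hgeo : HasSum (fun d : ℕ => z * z ^ d) (z * (1 - z)⁻¹) :=
      (hasSum_geometric_of_norm_lt_one hz).mul_left z
    have hprod : Summable fun p : StrictTuple r × ℕ =>
        polylogTerm k z p.1 * (z * z ^ p.2) :=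
      summable_mul_of_summable_norm (f := polylogTerm k z) (g := fun d : ℕ => z * z ^ d)
        hs.summable.norm hgeo.summable.norm
    have hmul := hs.mul hgeo hprod
    have hfun : polylogTerm (Fin.snoc (α := fun _ => ℕ) k 0) z ∘ strictTupleEquiv r =
        fun p : StrictTuple r × ℕ => polylogTerm k z p.1 * (z * z ^ p.2) := by
      funext p
      simp only [Function.comp, polylogTerm]
      rw [sup_strictTupleEquiv, Fin.prod_univ_castSucc]
      simp only [strictTupleEquiv, Equiv.coe_fn_mk, Fin.snoc_castSucc, Fin.snoc_last, pow_zero,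
        mul_one]
      rw [pow_add, pow_add, pow_one]
      ring
    refine (multiPolylog_hasSum _ hz).unique ?_
    rw [← (strictTupleEquiv r).hasSum_iff, hfun]
    exact hmul

theorem multiPolylog_fin_zero (k : Fin 0 → ℕ) : ∀ z ∈ polylogDomain, multiPolylog k z = 1 := by
  refine eqOn_polylogDomain (multiPolylog_differentiableOn _) (differentiableOn_const _) ?_
  intro z hz
  let m₀ : StrictTuple 0 := ⟨Fin.elim0, fun i => i.elim0, fun i => i.elim0⟩
  have hsub : ∀ m : StrictTuple 0, m = m₀ := fun m => Subtype.ext (Subsingleton.elim _ _)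
  have h := hasSum_single (f := polylogTerm k z) m₀ (fun m hm => absurd (hsub m) hm)
  rw [(multiPolylog_hasSum k hz).unique h]
  simp [polylogTerm]

theorem multiPolylog_apply_zero {r : ℕ} (hr : 1 ≤ r) (k : Fin r → ℕ) : multiPolylog k 0 = 0 := by
  refine (multiPolylog_hasSum k (by simp)).unique ?_
  convert! hasSum_zero with m
  have h := (m.2.2 ⟨0, hr⟩).trans (Finset.le_sup (f := m.1) (Finset.mem_univ _))
  rw [polylogTerm, zero_pow (by omega), zero_div]

/-! ### Polylogarithms as iterated integrals. -/

section IteratedIntegrals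

open MeasureTheory Set Filter Topology ENNReal

/-- The kernel `e^{-δt} / (1 - e^{-t})`, which is `1 / (e^t - 1)` for `δ = 1` and
`e^t / (e^t - 1)` for `δ = 0`. -/
noncomputable def bernoulliKernel (δ : ℕ) (t : ℝ) : ℝ :=
  Real.exp (-(δ * t)) / (1 - Real.exp (-t))

/-- The density attached to a letter: the letter `true` stands for the kernel, `false` for `1`. -/
noncomputable def letterDensity (δ : ℕ) : Bool → ℝ → ℝ≥0∞
  | true, t => ENNReal.ofReal (bernoulliKernel δ t)
  | false, _ => 1

/-- The iterated integral over `0 < t_N < ⋯ < t_1 < t` attached to a word, whose first letter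
belongs to the largest variable. -/
noncomputable def headIntegral (δ : ℕ) : List Bool → ℝ → ℝ≥0∞
  | [], _ => 1
  | b :: v, t => ∫⁻ u in Ioo 0 t, letterDensity δ b u * headIntegral δ v u

/-- The word of the dual index. -/
def dualWord {r : ℕ} (k : Fin r → ℕ) : List Bool :=
  (indexToWord (List.ofFn k)).reverse.map not

theorem one_sub_exp_neg_pos {t : ℝ} (ht : 0 < t) : 0 < 1 - Real.exp (-t) := by
  have := Real.exp_lt_one_iff.2 (neg_lt_zero.2 ht)
  linarith

theorem bernoulliKernel_pos (δ : ℕ) {t : ℝ} (ht : 0 < t) : 0 < bernoulliKernel δ t :=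
  div_pos (Real.exp_pos _) (one_sub_exp_neg_pos ht)

/-- Equivalent to `1 + t ≤ e^t`; the pole at 0 is simple. -/
theorem bernoulliKernel_le (δ : ℕ) {t : ℝ} (ht : 0 < t) :
    bernoulliKernel δ t ≤ Real.exp (-(δ * t)) * ((1 + t) / t) := by
  have h1 := one_sub_exp_neg_pos ht
  rw [bernoulliKernel, div_eq_mul_inv]
  gcongr
  rw [inv_le_comm₀ h1 (by positivity), inv_div, div_le_iff₀ (by positivity)]
  have h2 := Real.add_one_le_exp t
  have h3 : Real.exp (-t) * Real.exp t = 1 := by rw [← Real.exp_add]; simp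
  nlinarith [Real.exp_pos (-t)]

@[fun_prop]
theorem measurable_bernoulliKernel (δ : ℕ) : Measurable (bernoulliKernel δ) := by
  unfold bernoulliKernel
  fun_prop

@[fun_prop]
theorem measurable_letterDensity (δ : ℕ) (b : Bool) : Measurable (letterDensity δ b) := by
  cases b
  · exact measurable_const
  · exact (measurable_bernoulliKernel δ).ennreal_ofReal

@[fun_prop]
theorem measurable_headIntegral (δ : ℕ) (v : List Bool) : Measurable (headIntegral δ v) := by
  cases v with
  | nil => exact measurable_const
  | cons b v =>
    refine Monotone.measurable fun s t hst => ?_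
    exact lintegral_mono_set (Ioo_subset_Ioo_right hst)

/-- The innermost letter `false` integrates to `t`, and this zero at 0 cancels the simple pole of
the next kernel. Integration restores the zero, so each further letter costs at most a factor `1 +
t`. -/
theorem headIntegral_append_false_le (δ : ℕ) (v : List Bool) {t : ℝ} (ht : 0 ≤ t) :
    headIntegral δ (v ++ [false]) t ≤ ENNReal.ofReal (t * (1 + t) ^ v.length) := by
  induction v generalizing t with
  | nil => simp [headIntegral, letterDensity]
  | cons b v ih =>
    have hb : ∀ u ∈ Ioo 0 t, letterDensity δ b u * headIntegral δ (v ++ [false]) u ≤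
        ENNReal.ofReal ((1 + t) ^ (v.length + 1)) := by
      intro u hu
      have hu0 : 0 < u := hu.1
      have h1 : letterDensity δ b u ≤ ENNReal.ofReal ((1 + u) / u) := by
        cases b
        · rw [letterDensity, ENNReal.one_le_ofReal, le_div_iff₀ hu0]
          linarith
        · refine ENNReal.ofReal_le_ofReal ((bernoulliKernel_le δ hu0).trans ?_)
          refine mul_le_of_le_one_left (by positivity) (Real.exp_le_one_iff.2 ?_)
          have : (0 : ℝ) ≤ δ * u := by positivity
          linarith
      refine (mul_le_mul' h1 (ih hu0.le)).trans ?_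
      rw [← ENNReal.ofReal_mul (by positivity)]
      refine ENNReal.ofReal_le_ofReal ?_
      have : (1 + u) / u * (u * (1 + u) ^ v.length) = (1 + u) ^ (v.length + 1) := by
        field_simp
        ring
      rw [this]
      have := hu.2.le
      gcongr
    calc headIntegral δ (b :: v ++ [false]) t
        = ∫⁻ u in Ioo 0 t, letterDensity δ b u * headIntegral δ (v ++ [false]) u := rfl
      _ ≤ ∫⁻ _ in Ioo 0 t, ENNReal.ofReal ((1 + t) ^ (v.length + 1)) :=
          setLIntegral_mono measurable_const hb
      _ = _ := by
          rw [setLIntegral_const, Real.volume_Ioo, sub_zero, ← ENNReal.ofReal_mul (by positivity),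
            mul_comm]
          rfl

/-- A primitive, up to a constant factor, of a nonnegative function is given by its integral, and
this integral is finite. -/
theorem eq_mul_toReal_lintegral_of_hasDerivAt {F : ℝ → ℂ} {g : ℝ → ℝ} {c : ℂ} (hc : c ≠ 0) {t : ℝ}
    (ht : 0 ≤ t) (hcont : ContinuousOn F (Icc 0 t)) (hF : F 0 = 0)
    (hd : ∀ u ∈ Ioo 0 t, HasDerivAt F (c * g u) u) (hg : ∀ u ∈ Ioo 0 t, 0 ≤ g u) :
    ∫⁻ u in Ioo 0 t, ENNReal.ofReal (g u) ≠ ⊤ ∧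
      F t = c * ((∫⁻ u in Ioo 0 t, ENNReal.ofReal (g u)).toReal : ℝ) := by
  have hd' : ∀ u ∈ Ioo 0 t, HasDerivAt (fun u => c⁻¹ * F u) (g u : ℂ) u := by
    intro u hu
    have := (hd u hu).const_mul c⁻¹
    rwa [← mul_assoc, inv_mul_cancel₀ hc, one_mul] at this
  have hcont' : ContinuousOn (fun u => c⁻¹ * F u) (Icc 0 t) := continuousOn_const.mul hcont
  -- Integrability need not be assumed: a continuous primitive with nonnegative derivative forces
  -- it.
  have hint : IntegrableOn g (Ioc 0 t) := by
    refine intervalIntegral.integrableOn_deriv_of_nonneg (g := fun u => (c⁻¹ * F u).re)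
      (Complex.continuous_re.comp_continuousOn hcont') (fun u hu => ?_) hg
    have := (Complex.reCLM.hasFDerivAt (x := c⁻¹ * F u)).comp_hasDerivAt u (hd' u hu)
    simpa only [Complex.reCLM_apply, Complex.ofReal_re] using! this
  have hint' : IntegrableOn g (Ioo 0 t) := hint.mono_set Ioo_subset_Ioc_self
  have hftc := intervalIntegral.integral_eq_sub_of_hasDerivAt_of_le ht hcont' hd' (by
    rw [intervalIntegrable_iff_integrableOn_Ioc_of_le ht]
    exact hint.ofReal)
  rw [intervalIntegral.integral_ofReal, intervalIntegral.integral_of_le ht,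
    integral_Ioc_eq_integral_Ioo, hF, mul_zero, sub_zero] at hftc
  have hnn : 0 ≤ᵐ[volume.restrict (Ioo 0 t)] g := by
    filter_upwards [ae_restrict_mem measurableSet_Ioo] with u hu using hg u hu
  have hl := ofReal_integral_eq_lintegral_ofReal hint' hnn
  rw [← hl]
  refine ⟨ENNReal.ofReal_ne_top, ?_⟩
  rw [ENNReal.toReal_ofReal (integral_nonneg_of_ae hnn), hftc, ← mul_assoc, mul_inv_cancel₀ hc,
    one_mul]

/-- Reversal moves the last letter of the word of `k` to the front. So the first letter of the dual
word tells which differential equation governs the last entry. -/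
theorem dualWord_snoc_add_two {r : ℕ} (k : Fin r → ℕ) (a : ℕ) :
    dualWord (Fin.snoc (α := fun _ => ℕ) k (a + 2) : Fin (r + 1) → ℕ) =
      true :: dualWord (Fin.snoc (α := fun _ => ℕ) k (a + 1) : Fin (r + 1) → ℕ) := by
  rw [dualWord, dualWord, List.ofFn_succ', List.ofFn_succ']
  simp [indexToWord, List.replicate_succ']

theorem dualWord_snoc_one {r : ℕ} (k : Fin r → ℕ) :
    dualWord (Fin.snoc (α := fun _ => ℕ) k 1 : Fin (r + 1) → ℕ) = false :: dualWord k := by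
  rw [dualWord, List.ofFn_succ']
  simp [dualWord, indexToWord]

/-- Multiple polylogarithms at `1 - e^{-t}` (for `δ = 1`) and at `1 - e^t` (for `δ = 0`) are
iterated integrals. -/
theorem multiPolylog_eq_headIntegral {δ : ℕ} {σ : ℝ} (hσ : δ = 1 ∧ σ = 1 ∨ δ = 0 ∧ σ = -1)
    {r : ℕ} (k : Fin r → ℕ) (hk : ∀ i, 1 ≤ k i) {t : ℝ} (ht : 0 ≤ t) :
    headIntegral δ (dualWord k) t ≠ ⊤ ∧
      multiPolylog k (1 - Complex.exp (-(σ * t))) =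
        σ ^ r * ((headIntegral δ (dualWord k) t).toReal : ℝ) := by
  have hσ0 : (σ : ℂ) ≠ 0 := by
    rcases hσ with ⟨-, rfl⟩ | ⟨-, rfl⟩ <;> norm_num
  have hmem : ∀ u : ℝ, 1 - Complex.exp (-(σ * u)) ∈ polylogDomain := by
    intro u
    rw [polylogDomain_iff, _root_.sub_sub_cancel,
      show Complex.exp (-(σ * u)) = ((Real.exp (-(σ * u)) : ℝ) : ℂ) by push_cast; rfl]
    exact Complex.ofReal_mem_slitPlane.2 (Real.exp_pos _)
  have hne : ∀ u : ℝ, 0 < u → (1 : ℂ) - Complex.exp (-(σ * u)) ≠ 0 := by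
    intro u hu h
    have h1 : Real.exp (-(σ * u)) = 1 := by
      have : (1 : ℂ) - ((Real.exp (-(σ * u)) : ℝ) : ℂ) = 0 := by
        push_cast; exact h
      exact_mod_cast (sub_eq_zero.1 this).symm
    rw [Real.exp_eq_one_iff] at h1
    rcases hσ with ⟨-, rfl⟩ | ⟨-, rfl⟩ <;> linarith
  -- Pullback of `dz/z`; no sign survives for either value of `σ`.
  have hker : ∀ u : ℝ, 0 < u → (σ : ℂ) * Complex.exp (-(σ * u)) / (1 - Complex.exp (-(σ * u))) =
      (bernoulliKernel δ u : ℝ) := by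
    intro u hu
    have h1 := hne u hu
    rcases hσ with ⟨rfl, rfl⟩ | ⟨rfl, rfl⟩
    · simp [bernoulliKernel]
    · have h2 := (one_sub_exp_neg_pos hu).ne'
      have h3 : (1 : ℂ) - Complex.exp (-u) ≠ 0 := by exact_mod_cast h2
      have h4 : Complex.exp u * Complex.exp (-u) = 1 := by rw [← Complex.exp_add]; simp
      simp only [bernoulliKernel]
      push_cast at h1 ⊢
      simp only [neg_mul, one_mul, neg_neg, zero_mul, neg_zero, Complex.exp_zero] at h1 ⊢
      rw [div_eq_div_iff h1 h3]
      linear_combination h4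
  have hpath : ∀ {s : ℕ} (k : Fin s → ℕ) (u : ℝ),
      HasDerivAt (fun u : ℝ => multiPolylog k (1 - Complex.exp (-(σ * u))))
        (deriv (multiPolylog k) (1 - Complex.exp (-(σ * u))) *
          (σ * Complex.exp (-(σ * u)))) u := by
    intro s k u
    have h1 := ((multiPolylog_differentiableOn k).differentiableAt
      (polylogDomain_isOpen.mem_nhds (hmem u))).hasDerivAt
    have h2 : HasDerivAt (fun u : ℂ => 1 - Complex.exp (-(σ * u)))
        (σ * Complex.exp (-(σ * u))) (u : ℂ) := by
      have h3 : HasDerivAt (fun u : ℂ => -(σ * u)) (-(σ * 1)) (u : ℂ) :=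
        ((hasDerivAt_id (u : ℂ)).const_mul (σ : ℂ)).neg
      convert! h3.cexp.const_sub 1 using 1
      ring
    exact (h1.comp (u : ℂ) h2).comp_ofReal
  have hstep : ∀ {s : ℕ} (k : Fin (s + 1) → ℕ) (b : Bool) (v : List Bool) {t : ℝ}, 0 ≤ t →
      (∀ u ∈ Ioo 0 t, headIntegral δ v u ≠ ⊤) →
      (∀ u ∈ Ioo 0 t, deriv (multiPolylog k) (1 - Complex.exp (-(σ * u))) *
          (σ * Complex.exp (-(σ * u))) =
        σ ^ (s + 1) * ((letterDensity δ b u * headIntegral δ v u).toReal : ℝ)) →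
      headIntegral δ (b :: v) t ≠ ⊤ ∧ multiPolylog k (1 - Complex.exp (-(σ * t))) =
        σ ^ (s + 1) * ((headIntegral δ (b :: v) t).toReal : ℝ) := by
    intro s k b v t ht hfin hder
    have hL : headIntegral δ (b :: v) t = ∫⁻ u in Ioo 0 t,
        ENNReal.ofReal (letterDensity δ b u * headIntegral δ v u).toReal := by
      rw [headIntegral]
      refine setLIntegral_congr_fun measurableSet_Ioo fun u hu => (ENNReal.ofReal_toReal ?_).symm
      refine ENNReal.mul_ne_top ?_ (hfin u hu)
      cases b
      · exact ENNReal.one_ne_top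
      · exact ENNReal.ofReal_ne_top
    rw [hL]
    refine eq_mul_toReal_lintegral_of_hasDerivAt (pow_ne_zero _ hσ0) ht
      (F := fun u => multiPolylog k (1 - Complex.exp (-(σ * u))))
      (fun u _ => (hpath k u).continuousAt.continuousWithinAt) ?_ (fun u hu => ?_)
      (fun u _ => ENNReal.toReal_nonneg)
    · simp [multiPolylog_apply_zero]
    · rw [← hder u hu]
      exact hpath k u
  induction r generalizing t with
  | zero =>
    simp [dualWord, indexToWord, headIntegral, multiPolylog_fin_zero k _ (hmem t)]
  | succ r ih =>
    obtain ⟨k', a, rfl⟩ : ∃ (k' : Fin r → ℕ) (a : ℕ), k = Fin.snoc (α := fun _ => ℕ) k' a :=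
      ⟨fun i => k i.castSucc, k (Fin.last r), by
        funext i; induction i using Fin.lastCases <;> simp⟩
    have hk' : ∀ i, 1 ≤ k' i := fun i => by simpa using hk i.castSucc
    have ha : 1 ≤ a := by simpa using hk (Fin.last r)
    clear hk
    have hode : ∀ (a : ℕ) (u : ℝ), 0 < u →
        deriv (multiPolylog (Fin.snoc (α := fun _ => ℕ) k' (a + 1) : Fin (r + 1) → ℕ))
          (1 - Complex.exp (-(σ * u))) =
        multiPolylog (Fin.snoc (α := fun _ => ℕ) k' a : Fin (r + 1) → ℕ)
          (1 - Complex.exp (-(σ * u))) / (1 - Complex.exp (-(σ * u))) := by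
      intro a u hu
      rw [eq_div_iff (hne u hu), mul_comm]
      exact mul_deriv_multiPolylog k' a _ (hmem u)
    induction a, ha using Nat.le_induction generalizing t with
    | base =>
      rw [dualWord_snoc_one]
      refine hstep _ _ _ ht (fun u hu => (ih k' hk' hu.1.le).1) fun u hu => ?_
      -- Pullback of `dz/(1-z)`: since `1 - z = e^{-σu}`, it is `σ du`, so each unit of depth
      -- contributes one factor `σ`.
      rw [hode 0 u hu.1, multiPolylog_snoc_zero _ _ (hmem u), (ih k' hk' hu.1.le).2, letterDensity,
        one_mul]
      have h1 := hne u hu.1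
      have h2 := Complex.exp_ne_zero (-(σ * u) : ℂ)
      field_simp
      simp only [_root_.sub_sub_cancel]
      ring
    | succ a ha iha =>
      obtain ⟨a, rfl⟩ : ∃ b, a = b + 1 := ⟨a - 1, by omega⟩
      rw [dualWord_snoc_add_two]
      refine hstep _ _ _ ht (fun u hu => (iha hu.1.le).1) fun u hu => ?_
      rw [hode (a + 1) u hu.1, (iha hu.1.le).2, letterDensity, ENNReal.toReal_mul,
        ENNReal.toReal_ofReal (bernoulliKernel_pos δ hu.1).le, Complex.ofReal_mul, ← hker u hu.1]
      ring

/-! ### Erlang densities and integration from the outermost variable. -/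

/-- The density `t^i / i! * e^{-Mt}`. -/
noncomputable def erlangDensity (i M : ℕ) (t : ℝ) : ℝ≥0∞ :=
  ENNReal.ofReal (t ^ i / i.factorial * Real.exp (-(M * t)))

@[fun_prop]
theorem measurable_erlangDensity (i M : ℕ) : Measurable (erlangDensity i M) := by
  unfold erlangDensity
  fun_prop

/-- Integration by parts: the primitive for `i + 1` is `1/M` times the primitive for `i` minus
`t^{i+1}/(i+1)! * e^{-Mt}`. -/
theorem hasDerivAt_erlang (i : ℕ) {M : ℕ} (hM : 1 ≤ M) (t : ℝ) :
    HasDerivAt (fun t : ℝ => -∑ p ∈ Finset.HasAntidiagonal.antidiagonal i,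
        ((M : ℝ)⁻¹) ^ (p.1 + 1) * (t ^ p.2 / p.2.factorial * Real.exp (-(M * t))))
      (t ^ i / i.factorial * Real.exp (-(M * t))) t := by
  have hM0 : (M : ℝ) ≠ 0 := by positivity
  have hexp : HasDerivAt (fun t : ℝ => Real.exp (-(M * t)))
      (Real.exp (-(M * t)) * -(M * 1)) t :=
    (((hasDerivAt_id t).const_mul (M : ℝ)).neg).exp
  induction i with
  | zero =>
    simp only [Finset.Nat.antidiagonal_zero, Finset.sum_singleton]
    convert! (((hasDerivAt_const t (1 : ℝ)).mul hexp).const_mul ((M : ℝ)⁻¹ ^ 1)).neg using 1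
    · funext t; simp
    · field_simp; simp
  | succ i ih =>
    have h1 : HasDerivAt (fun t : ℝ => t ^ (i + 1) / (i + 1).factorial)
        (t ^ i / i.factorial) t := by
      convert! (hasDerivAt_pow (i + 1) t).div_const ((i + 1).factorial : ℝ) using 1
      rw [Nat.factorial_succ]
      push_cast
      have : ((i : ℝ) + 1) ≠ 0 := by positivity
      field_simp
    have h2 := ((ih.sub (h1.mul hexp)).const_mul ((M : ℝ)⁻¹))
    convert! h2 using 1
    · funext t
      simp only [Finset.Nat.sum_antidiagonal_succ, Pi.sub_apply, Pi.mul_apply]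
      rw [mul_sub, mul_neg, Finset.mul_sum, neg_add, add_comm, ← sub_eq_add_neg]
      congr 1
      · congr 1
        refine Finset.sum_congr rfl fun p _ => ?_
        ring
      · ring
    · field_simp
      ring

theorem tendsto_erlang (i : ℕ) {M : ℕ} (hM : 1 ≤ M) :
    Tendsto (fun t : ℝ => -∑ p ∈ Finset.HasAntidiagonal.antidiagonal i,
        ((M : ℝ)⁻¹) ^ (p.1 + 1) * (t ^ p.2 / p.2.factorial * Real.exp (-(M * t))))
      atTop (𝓝 0) := by
  have h : ∀ n : ℕ, Tendsto (fun t : ℝ => t ^ n * Real.exp (-(M * t))) atTop (𝓝 0) := by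
    intro n
    refine squeeze_zero' ?_ ?_ (Real.tendsto_pow_mul_exp_neg_atTop_nhds_zero n)
    · filter_upwards [eventually_ge_atTop 0] with t ht
      positivity
    · filter_upwards [eventually_ge_atTop 0] with t ht
      have h1 : (1 : ℝ) ≤ M := by exact_mod_cast hM
      gcongr
      nlinarith
  rw [← neg_zero]
  refine Tendsto.neg ?_
  rw [show (0 : ℝ) = ∑ p ∈ Finset.HasAntidiagonal.antidiagonal i,
    ((M : ℝ)⁻¹) ^ (p.1 + 1) / p.2.factorial * 0 by simp]
  refine tendsto_finsetSum _ fun p _ => ?_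
  convert! (h p.2).const_mul (((M : ℝ)⁻¹) ^ (p.1 + 1) / p.2.factorial) using 2 with t
  ring

/-- The right side is a Cauchy product with the coefficients of `1/(M - X)`; this motivates
generating series over `i`. -/
theorem lintegral_erlangDensity (i : ℕ) {M : ℕ} (hM : 1 ≤ M) {u : ℝ} (hu : 0 ≤ u) :
    ∫⁻ t in Ioi u, erlangDensity i M t =
      ∑ p ∈ Finset.HasAntidiagonal.antidiagonal i, ((M : ℝ≥0∞)⁻¹) ^ (p.1 + 1) * erlangDensity p.2 M u := by
  have hnn : ∀ t ∈ Ioi u, 0 ≤ t ^ i / i.factorial * Real.exp (-(M * t)) := by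
    intro t ht
    have : 0 < t := hu.trans_lt ht
    positivity
  have hint := integrableOn_Ioi_deriv_of_nonneg
    (hasDerivAt_erlang i hM u).continuousAt.continuousWithinAt
    (fun t _ => hasDerivAt_erlang i hM t) hnn (tendsto_erlang i hM)
  have hval := integral_Ioi_of_hasDerivAt_of_nonneg
    (hasDerivAt_erlang i hM u).continuousAt.continuousWithinAt
    (fun t _ => hasDerivAt_erlang i hM t) hnn (tendsto_erlang i hM)
  have hae : 0 ≤ᵐ[volume.restrict (Ioi u)] fun t => t ^ i / i.factorial * Real.exp (-(M * t)) := by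
    filter_upwards [ae_restrict_mem measurableSet_Ioi] with t ht using hnn t ht
  unfold erlangDensity
  rw [← ofReal_integral_eq_lintegral_ofReal hint hae, hval, zero_sub, neg_neg,
    ENNReal.ofReal_sum_of_nonneg (fun p _ => by positivity)]
  refine Finset.sum_congr rfl fun p _ => ?_
  rw [ENNReal.ofReal_mul (by positivity), ENNReal.ofReal_pow (by positivity),
    ENNReal.ofReal_inv_of_pos (by positivity), ENNReal.ofReal_natCast]

theorem ofReal_bernoulliKernel (δ : ℕ) {t : ℝ} (ht : 0 < t) :
    ENNReal.ofReal (bernoulliKernel δ t) =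
      ∑' l : ℕ, ENNReal.ofReal (Real.exp (-((δ + l : ℕ) * t))) := by
  have hlt : Real.exp (-t) < 1 := Real.exp_lt_one_iff.2 (neg_lt_zero.2 ht)
  have hs : HasSum (fun l : ℕ => Real.exp (-((δ + l : ℕ) * t))) (bernoulliKernel δ t) := by
    convert! (hasSum_geometric_of_lt_one (Real.exp_pos (-t)).le hlt).mul_left
      (Real.exp (-(δ * t))) using 1
    funext l
    rw [← Real.exp_nat_mul, ← Real.exp_add]
    congr 1
    push_cast
    ring
  rw [← hs.tsum_eq, ENNReal.ofReal_tsum_of_nonneg (fun _ => (Real.exp_pos _).le) hs.summable]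

/-- Expanding the kernel geometrically changes only the decay rate; the rates that appear become the
next summation variable. -/
theorem erlangDensity_mul_bernoulliKernel (i M δ : ℕ) {t : ℝ} (ht : 0 < t) :
    erlangDensity i M t * ENNReal.ofReal (bernoulliKernel δ t) =
      ∑' l : ℕ, erlangDensity i (M + δ + l) t := by
  rw [ofReal_bernoulliKernel δ ht, ← ENNReal.tsum_mul_left]
  refine tsum_congr fun l => ?_
  rw [erlangDensity, erlangDensity, ← ENNReal.ofReal_mul (by positivity), mul_assoc,
    ← Real.exp_add]
  congr 4
  push_cast
  ring

/-- Tonelli on the triangle `0 < u < t`, so that the largest variable can be integrated out first.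
-/
theorem lintegral_mul_lintegral_Ioo {G H : ℝ → ℝ≥0∞} (hG : Measurable G) (hH : Measurable H) :
    ∫⁻ t in Ioi 0, G t * ∫⁻ u in Ioo 0 t, H u = ∫⁻ u in Ioi 0, (∫⁻ t in Ioi u, G t) * H u := by
  have hset : MeasurableSet {p : ℝ × ℝ | 0 < p.2 ∧ p.2 < p.1} :=
    (measurableSet_lt measurable_const measurable_snd).inter
      (measurableSet_lt measurable_snd measurable_fst)
  have hK : Measurable ({p : ℝ × ℝ | 0 < p.2 ∧ p.2 < p.1}.indicator fun p => G p.1 * H p.2) :=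
    Measurable.indicator (by fun_prop) hset
  have h := lintegral_lintegral_swap (μ := (volume : Measure ℝ)) (ν := (volume : Measure ℝ))
    (f := fun t u => {p : ℝ × ℝ | 0 < p.2 ∧ p.2 < p.1}.indicator (fun p => G p.1 * H p.2) (t, u))
    hK.aemeasurable
  convert! h using 1
  · rw [← lintegral_indicator measurableSet_Ioi]
    refine lintegral_congr fun t => ?_
    by_cases ht : 0 < t
    · rw [indicator_of_mem (mem_Ioi.2 ht), ← lintegral_const_mul _ hH,
        ← lintegral_indicator measurableSet_Ioo]
      rfl
    · rw [indicator_of_notMem (by simpa using ht)]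
      symm
      convert! lintegral_zero with u
      refine indicator_of_notMem ?_ _
      rintro ⟨h1, h2⟩
      exact ht (h1.trans h2)
  · rw [← lintegral_indicator measurableSet_Ioi]
    refine lintegral_congr fun u => ?_
    by_cases hu : 0 < u
    · rw [indicator_of_mem (mem_Ioi.2 hu), ← lintegral_mul_const _ hG,
        ← lintegral_indicator measurableSet_Ioi]
      refine lintegral_congr fun t => ?_
      simp only [indicator, mem_Ioi, Set.mem_ofPred_eq, hu, true_and]
    · rw [indicator_of_notMem (by simpa using hu)]
      symm
      convert! lintegral_zero with t
      refine indicator_of_notMem ?_ _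
      rintro ⟨h1, -⟩
      exact hu h1

/-! ### Generating series of words. -/

/-- The power series `X ↦ 1 / (M - X)`. -/
noncomputable def poleSeries (M : ℕ) : PowerSeries ℝ≥0∞ :=
  PowerSeries.mk fun a => ((M : ℝ≥0∞)⁻¹) ^ (a + 1)

/-- The coefficientwise sum of a sequence of power series. -/
noncomputable def seriesSum (f : ℕ → PowerSeries ℝ≥0∞) : PowerSeries ℝ≥0∞ :=
  PowerSeries.mk fun i => ∑' l, PowerSeries.coeff i (f l)

/-- The generating series of the integrals of the head integrals of a word against the densities
`t^i / i! * e^{-Mt}`. -/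
noncomputable def wordSeries (δ : ℕ) : List Bool → ℕ → PowerSeries ℝ≥0∞
  | [], M => poleSeries M
  | false :: v, M => poleSeries M * wordSeries δ v M
  | true :: v, M => poleSeries M * seriesSum fun l => wordSeries δ v (M + δ + l)

theorem lintegral_erlangDensity_mul_headIntegral_cons (δ : ℕ) (b : Bool) (v : List Bool) (i : ℕ)
    {M : ℕ} (hM : 1 ≤ M) :
    ∫⁻ t in Ioi 0, erlangDensity i M t * headIntegral δ (b :: v) t =
      ∑ p ∈ Finset.HasAntidiagonal.antidiagonal i, ((M : ℝ≥0∞)⁻¹) ^ (p.1 + 1) *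
        ∫⁻ t in Ioi 0, erlangDensity p.2 M t * (letterDensity δ b t * headIntegral δ v t) := by
  simp only [headIntegral]
  rw [lintegral_mul_lintegral_Ioo (by fun_prop) (by fun_prop)]
  have : ∀ u ∈ Ioi (0 : ℝ), (∫⁻ t in Ioi u, erlangDensity i M t) *
      (letterDensity δ b u * headIntegral δ v u) =
      ∑ p ∈ Finset.HasAntidiagonal.antidiagonal i, ((M : ℝ≥0∞)⁻¹) ^ (p.1 + 1) *
        (erlangDensity p.2 M u * (letterDensity δ b u * headIntegral δ v u)) := by
    intro u hu
    rw [lintegral_erlangDensity i hM (le_of_lt hu), Finset.sum_mul]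
    exact Finset.sum_congr rfl fun p _ => mul_assoc _ _ _
  rw [setLIntegral_congr_fun measurableSet_Ioi this, lintegral_finsetSum _ (by fun_prop)]
  exact Finset.sum_congr rfl fun p _ => lintegral_const_mul _ (by fun_prop)

theorem lintegral_erlangDensity_mul_headIntegral (δ : ℕ) (v : List Bool) (i : ℕ) {M : ℕ}
    (hM : 1 ≤ M) :
    ∫⁻ t in Ioi 0, erlangDensity i M t * headIntegral δ v t =
      PowerSeries.coeff i (wordSeries δ v M) := by
  induction v generalizing i M with
  | nil =>
    simp only [headIntegral, mul_one, wordSeries, poleSeries, PowerSeries.coeff_mk]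
    rw [lintegral_erlangDensity i hM le_rfl, Finset.sum_eq_single (i, 0)]
    · simp [erlangDensity]
    · rintro ⟨a, b⟩ hp hne
      have hb : b ≠ 0 := by
        rintro rfl
        rw [Finset.HasAntidiagonal.mem_antidiagonal] at hp
        exact hne (by simpa using hp)
      simp [erlangDensity, hb]
    · simp
  | cons b v ih =>
    rw [lintegral_erlangDensity_mul_headIntegral_cons δ b v i hM]
    cases b with
    | false =>
      rw [wordSeries, PowerSeries.coeff_mul]
      refine Finset.sum_congr rfl fun p _ => ?_
      simp only [letterDensity, one_mul]
      rw [ih p.2 hM, poleSeries, PowerSeries.coeff_mk]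
    | true =>
      rw [wordSeries, PowerSeries.coeff_mul]
      refine Finset.sum_congr rfl fun p _ => ?_
      rw [poleSeries, PowerSeries.coeff_mk, seriesSum, PowerSeries.coeff_mk]
      congr 1
      have h : ∀ t ∈ Ioi (0 : ℝ), erlangDensity p.2 M t *
          (letterDensity δ true t * headIntegral δ v t) =
          ∑' l : ℕ, erlangDensity p.2 (M + δ + l) t * headIntegral δ v t := by
        intro t ht
        rw [← mul_assoc, letterDensity, erlangDensity_mul_bernoulliKernel _ _ _ ht,
          ENNReal.tsum_mul_right]
      rw [setLIntegral_congr_fun measurableSet_Ioi h, lintegral_tsum (by fun_prop)]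
      exact tsum_congr fun l => ih p.2 (by omega)

/-- The outer kernel has parameter 1 whatever `δ` is, so the smallest summation variable starts at 1
for both ξ and η. -/
theorem lintegral_pow_mul_headIntegral (δ : ℕ) (v : List Bool) (q : ℕ) :
    ∫⁻ t in Ioi 0, ENNReal.ofReal (t ^ q / q.factorial) *
        (ENNReal.ofReal (bernoulliKernel 1 t) * headIntegral δ v t) =
      PowerSeries.coeff q (seriesSum fun l => wordSeries δ v (1 + l)) := by
  have h : ∀ t ∈ Ioi (0 : ℝ), ENNReal.ofReal (t ^ q / q.factorial) *
      (ENNReal.ofReal (bernoulliKernel 1 t) * headIntegral δ v t) =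
      ∑' l : ℕ, erlangDensity q (1 + l) t * headIntegral δ v t := by
    intro t ht
    -- A density of rate 0; the kernel raises the rate to at least 1 before anything is integrated.
    have h0 : ENNReal.ofReal (t ^ q / q.factorial) = erlangDensity q 0 t := by
      simp [erlangDensity]
    rw [← mul_assoc, h0, erlangDensity_mul_bernoulliKernel _ _ _ ht, zero_add,
      ENNReal.tsum_mul_right]
  rw [setLIntegral_congr_fun measurableSet_Ioi h, lintegral_tsum (by fun_prop), seriesSum,
    PowerSeries.coeff_mk]
  exact tsum_congr fun l => lintegral_erlangDensity_mul_headIntegral δ v q (by omega)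

/-! ### From words to indices. -/

theorem sum_antidiagonal_choose_sub_one (c a : ℕ) :
    ∑ p ∈ Finset.HasAntidiagonal.antidiagonal a, (c + p.1 - 1).choose p.1 = (c + a).choose a := by
  induction a with
  | zero => simp
  | succ a ih =>
    rw [Finset.Nat.sum_antidiagonal_succ', ih, ← add_assoc, Nat.add_sub_cancel,
      Nat.choose_succ_succ, add_comm]

/-- Negative binomial series for `(M - X)^{-c}`, the source of the binomials `b(l; j)`. -/
theorem coeff_poleSeries_pow (M c a : ℕ) :
    PowerSeries.coeff a (poleSeries M ^ c) =
      ((c + a - 1).choose a : ℝ≥0∞) * ((M : ℝ≥0∞)⁻¹) ^ (c + a) := by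
  induction c generalizing a with
  | zero =>
    rw [pow_zero, PowerSeries.coeff_one]
    rcases Nat.eq_zero_or_pos a with rfl | ha
    · simp
    · rw [if_neg ha.ne', zero_add, Nat.choose_eq_zero_of_lt (by omega), Nat.cast_zero, zero_mul]
  | succ c ih =>
    rw [pow_succ, PowerSeries.coeff_mul, add_right_comm, Nat.add_sub_cancel,
      ← sum_antidiagonal_choose_sub_one, Nat.cast_sum, Finset.sum_mul]
    refine Finset.sum_congr rfl fun p hp => ?_
    rw [ih, poleSeries, PowerSeries.coeff_mk, mul_assoc, ← pow_add,
      ← Finset.HasAntidiagonal.mem_antidiagonal.1 hp]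
    congr 2
    ring

/-- The generating series `∑ ∏ᵢ (mᵢ - X)^{-lᵢ}` over the tuples that satisfy `M + δ ≤ m₁` and
`mᵢ + δ ≤ mᵢ₊₁`. -/
noncomputable def indexSeries (δ : ℕ) : List ℕ → ℕ → PowerSeries ℝ≥0∞
  | [], _ => 1
  | l :: ls, M => seriesSum fun d => poleSeries (M + δ + d) ^ l * indexSeries δ ls (M + δ + d)

/-- The part of `indexSeries` with a prescribed first entry of the summation tuple. -/
noncomputable def indexSeriesAt (δ : ℕ) : List ℕ → ℕ → PowerSeries ℝ≥0∞
  | [], _ => 1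
  | l :: ls, M => poleSeries M ^ l * indexSeries δ ls M

theorem indexSeries_eq_seriesSum (δ : ℕ) {ls : List ℕ} (h : ls ≠ []) (M : ℕ) :
    indexSeries δ ls M = seriesSum fun d => indexSeriesAt δ ls (M + δ + d) := by
  cases ls with
  | nil => exact absurd rfl h
  | cons l ls => rfl

theorem wordToIndexFrom_ne_nil (c : ℕ) (v : List Bool) : wordToIndexFrom c v ≠ [] := by
  induction v generalizing c with
  | nil => simp [wordToIndexFrom]
  | cons b v ih => cases b <;> simp [wordToIndexFrom, ih]

/-- The counter of the reader records the pole factors at the current `M`: `c` are already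
collected, and one more is due from the letter or the end of the word that follows. A `false` adds a
factor at the same `M`; a `true` closes the entry and moves to a new summation variable. -/
theorem indexSeriesAt_wordToIndexFrom (δ c : ℕ) (v : List Bool) (M : ℕ) :
    indexSeriesAt δ (wordToIndexFrom (c + 1) v) M = poleSeries M ^ c * wordSeries δ v M := by
  induction v generalizing c M with
  | nil => simp [wordToIndexFrom, indexSeriesAt, indexSeries, wordSeries, pow_succ]
  | cons b v ih =>
    cases b with
    | false => rw [wordToIndexFrom, ih, wordSeries, pow_succ, mul_assoc]
    | true =>
      rw [wordToIndexFrom, indexSeriesAt, indexSeries_eq_seriesSum δ (wordToIndexFrom_ne_nil _ _),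
        wordSeries, pow_succ, mul_assoc]
      congr 3
      funext d
      rw [← zero_add 1, ih, pow_zero, one_mul]

/-- The base point `1 - δ` compensates the step `δ` built into `indexSeries`, so that the first
variable ranges over all integers from 1 on. -/
theorem seriesSum_wordSeries {δ : ℕ} (hδ : δ ≤ 1) (v : List Bool) :
    (seriesSum fun l => wordSeries δ v (1 + l)) =
      indexSeries δ (wordToIndex (true :: v)) (1 - δ) := by
  rw [wordToIndex, indexSeries_eq_seriesSum δ (wordToIndexFrom_ne_nil _ _)]
  congr 1
  funext l
  rw [← zero_add 1, indexSeriesAt_wordToIndexFrom, pow_zero, one_mul]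
  congr 1
  omega

/-! ### Coefficients as sums over tuples. -/

/-- The tuples with `M + δ ≤ mᵢ` for all `i` and `mᵢ + δ ≤ mⱼ` for all `i < j`. -/
def gapTuples (δ M n : ℕ) : Set (Fin n → ℕ) :=
  {m | (∀ i j, i < j → m i + δ ≤ m j) ∧ ∀ i, M + δ ≤ m i}

theorem cons_mem_gapTuples {δ M n a : ℕ} {m : Fin n → ℕ} :
    (Fin.cons a m : Fin (n + 1) → ℕ) ∈ gapTuples δ M (n + 1) ↔
      M + δ ≤ a ∧ m ∈ gapTuples δ a n := by
  simp only [gapTuples, Set.mem_ofPred_eq]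
  constructor
  · rintro ⟨h1, h2⟩
    refine ⟨by simpa using h2 0, fun i j hij => ?_, fun i => ?_⟩
    · simpa using h1 i.succ j.succ (Fin.succ_lt_succ_iff.2 hij)
    · simpa using h1 0 i.succ (Fin.succ_pos i)
  · rintro ⟨h1, h2, h3⟩
    constructor
    · intro i j hij
      induction j using Fin.cases with
      | zero => exact absurd hij (Fin.not_lt_zero i)
      | succ j =>
        induction i using Fin.cases with
        | zero => simpa using h3 j
        | succ i => simpa using h2 i j (Fin.succ_lt_succ_iff.1 hij)
    · intro i
      induction i using Fin.cases with
      | zero => simpa using h1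
      | succ i =>
        have := h3 i
        simp only [Fin.cons_succ]
        omega

theorem tsum_nat_add_eq_tsum_indicator (f : ℕ → ℝ≥0∞) (N : ℕ) :
    ∑' d, f (N + d) = ∑' a, (Ici N).indicator f a := by
  rw [← (add_right_injective N).tsum_eq (f := (Ici N).indicator f)]
  · exact tsum_congr fun d => (indicator_of_mem (by simp) _).symm
  · intro a ha
    have : N ≤ a := mem_of_indicator_ne_zero ha
    exact ⟨a - N, by simp; omega⟩

/-- Unfolds the nested sums by splitting off the smallest variable; indicators keep all sums over
the full type of tuples, where reindexing is easy. -/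
theorem coeff_indexSeries_ofFn (δ : ℕ) {n : ℕ} (l : Fin n → ℕ) (M q : ℕ) :
    PowerSeries.coeff q (indexSeries δ (List.ofFn l) M) =
      ∑' m, (gapTuples δ M n).indicator
        (fun m => PowerSeries.coeff q (∏ i, poleSeries (m i) ^ l i)) m := by
  induction n generalizing M q with
  | zero =>
    rw [tsum_eq_single (default : Fin 0 → ℕ) (fun m hm => absurd (Subsingleton.elim _ _) hm),
      indicator_of_mem (show default ∈ gapTuples δ M 0 from ⟨fun i => i.elim0, fun i => i.elim0⟩)]
    simp [indexSeries]
  | succ n ih =>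
    rw [List.ofFn_succ, indexSeries, seriesSum, PowerSeries.coeff_mk,
      tsum_nat_add_eq_tsum_indicator (fun a => PowerSeries.coeff q
        (poleSeries a ^ l 0 * indexSeries δ (List.ofFn fun i => l i.succ) a)),
      ← (Fin.consEquiv fun _ => ℕ).tsum_eq, ENNReal.tsum_prod']
    refine tsum_congr fun a => ?_
    by_cases ha : M + δ ≤ a
    · rw [indicator_of_mem (mem_Ici.2 ha), PowerSeries.coeff_mul]
      simp only [ih, ← ENNReal.tsum_mul_left]
      rw [← Summable.tsum_finsetSum fun _ _ => ENNReal.summable]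
      refine tsum_congr fun m => ?_
      change _ = (gapTuples δ M (n + 1)).indicator _ (Fin.cons a m : Fin (n + 1) → ℕ)
      by_cases hm : m ∈ gapTuples δ a n
      · rw [indicator_of_mem (cons_mem_gapTuples.2 ⟨ha, hm⟩), Fin.prod_univ_succ,
          PowerSeries.coeff_mul]
        exact Finset.sum_congr rfl fun p _ => by
          rw [indicator_of_mem hm]
          simp
      · rw [indicator_of_notMem fun h => hm (cons_mem_gapTuples.1 h).2]
        exact Finset.sum_eq_zero fun p _ => by rw [indicator_of_notMem hm, mul_zero]
    · rw [indicator_of_notMem (by simpa using ha)]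
      symm
      refine ENNReal.tsum_eq_zero.2 fun m => ?_
      exact indicator_of_notMem (fun h => ha (cons_mem_gapTuples.1 h).1) _

theorem zetaTerm_nonneg {n : ℕ} (l m : Fin n → ℕ) : 0 ≤ zetaTerm l m := by
  unfold zetaTerm
  positivity

theorem ofReal_zetaTerm {n : ℕ} (l : Fin n → ℕ) {m : Fin n → ℕ} (hm : ∀ i, 1 ≤ m i) :
    ENNReal.ofReal (zetaTerm l m) = ∏ i, ((m i : ℝ≥0∞)⁻¹) ^ l i := by
  rw [zetaTerm, one_div, ← Finset.prod_inv_distrib,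
    ENNReal.ofReal_prod_of_nonneg (fun i _ => by positivity)]
  refine Finset.prod_congr rfl fun i _ => ?_
  have : (0 : ℝ) < m i := by exact_mod_cast hm i
  rw [← inv_pow, ENNReal.ofReal_pow (by positivity), ENNReal.ofReal_inv_of_pos this,
    ENNReal.ofReal_natCast]

theorem coeff_prod_poleSeries_pow {n : ℕ} (l : Fin n → ℕ) {m : Fin n → ℕ} (hm : ∀ i, 1 ≤ m i)
    (q : ℕ) :
    PowerSeries.coeff q (∏ i, poleSeries (m i) ^ l i) =
      ∑ j ∈ Finset.piAntidiag (Finset.univ : Finset (Fin n)) q,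
        (indexBinom l j : ℝ≥0∞) * ENNReal.ofReal (zetaTerm (l + j) m) := by
  rw [PowerSeries.coeff_prod]
  refine Finset.sum_bij (fun f _ => ⇑f) ?_ ?_ ?_ ?_
  · intro f hf
    rw [Finset.mem_finsuppAntidiag] at hf
    simpa using hf.1
  · intro f _ g _ h
    exact DFunLike.coe_injective h
  · intro j hj
    refine ⟨Finsupp.equivFunOnFinite.symm j, ?_, rfl⟩
    rw [Finset.mem_finsuppAntidiag]
    simpa using hj
  · intro f _
    rw [ofReal_zetaTerm _ hm, indexBinom, Nat.cast_prod, ← Finset.prod_mul_distrib]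
    exact Finset.prod_congr rfl fun i _ => coeff_poleSeries_pow _ _ _

theorem one_le_of_mem_gapTuples {δ n : ℕ} {m : Fin n → ℕ} (hm : m ∈ gapTuples δ (1 - δ) n)
    (i : Fin n) : 1 ≤ m i := by
  have := hm.2 i
  omega

/-- The coefficients of the generating series of an index, as sums of multiple zeta (star)
series. -/
theorem coeff_indexSeries (δ : ℕ) {n : ℕ} (l : Fin n → ℕ) (q : ℕ) :
    PowerSeries.coeff q (indexSeries δ (List.ofFn l) (1 - δ)) =
      ∑ j ∈ Finset.piAntidiag (Finset.univ : Finset (Fin n)) q,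
        (indexBinom l j : ℝ≥0∞) *
          ∑' m : gapTuples δ (1 - δ) n, ENNReal.ofReal (zetaTerm (l + j) m) := by
  rw [coeff_indexSeries_ofFn, ← tsum_subtype]
  simp only [← ENNReal.tsum_mul_left]
  rw [← Summable.tsum_finsetSum fun _ _ => ENNReal.summable]
  exact tsum_congr fun m => coeff_prod_poleSeries_pow l (one_le_of_mem_gapTuples m.2) q

theorem mem_gapTuples_one_iff {n : ℕ} (m : Fin n → ℕ) :
    m ∈ gapTuples 1 (1 - 1) n ↔ StrictMono m ∧ ∀ i, 1 ≤ m i := by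
  simp [gapTuples, StrictMono, Nat.succ_le_iff]

theorem mem_gapTuples_zero_iff {n : ℕ} (m : Fin n → ℕ) :
    m ∈ gapTuples 0 (1 - 0) n ↔ Monotone m ∧ ∀ i, 1 ≤ m i := by
  simp only [gapTuples, monotone_iff_forall_lt, Set.mem_ofPred_eq, add_zero, tsub_zero]

/-! ### Combinatorics of the dual word. -/

theorem raiseLast_snoc {r : ℕ} (k : Fin r → ℕ) (a : ℕ) :
    raiseLast (Fin.snoc (α := fun _ => ℕ) k a : Fin (r + 1) → ℕ) =
      Fin.snoc (α := fun _ => ℕ) k (a + 1) := by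
  funext i
  induction i using Fin.lastCases with
  | last => simp [raiseLast]
  | cast i =>
    have := i.2.ne
    simp [raiseLast, this]

theorem exists_eq_snoc {r : ℕ} (k : Fin (r + 1) → ℕ) :
    ∃ (k' : Fin r → ℕ) (a : ℕ), k = Fin.snoc (α := fun _ => ℕ) k' a :=
  ⟨fun i => k i.castSucc, k (Fin.last r), by
    funext i; induction i using Fin.lastCases <;> simp⟩

/-- The new letter is the one accounted for by the factor `1/(e^t - 1)` of the defining integrals.
-/
theorem dualWord_raiseLast {r : ℕ} (hr : 1 ≤ r) (k : Fin r → ℕ) (hk : ∀ i, 1 ≤ k i) :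
    dualWord (raiseLast k) = true :: dualWord k := by
  obtain ⟨r, rfl⟩ : ∃ s, r = s + 1 := ⟨r - 1, by omega⟩
  obtain ⟨k', a, rfl⟩ := exists_eq_snoc k
  have ha : 1 ≤ a := by simpa using hk (Fin.last r)
  obtain ⟨a, rfl⟩ : ∃ b, a = b + 1 := ⟨a - 1, by omega⟩
  rw [raiseLast_snoc, dualWord_snoc_add_two]

/-- The word of a nonempty index begins with `true`. The resulting final `false` is what makes the
iterated integral converge at 0. -/
theorem exists_dualWord_eq_append {r : ℕ} (hr : 1 ≤ r) (k : Fin r → ℕ) :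
    ∃ v, dualWord k = v ++ [false] := by
  obtain ⟨r, rfl⟩ : ∃ s, r = s + 1 := ⟨r - 1, by omega⟩
  rw [dualWord, List.ofFn_succ, indexToWord, List.flatMap_cons, List.cons_append,
    List.reverse_cons, List.map_append]
  exact ⟨_, rfl⟩

theorem length_wordToIndexFrom (c : ℕ) (v : List Bool) :
    (wordToIndexFrom c v).length = v.count true + 1 := by
  induction v generalizing c with
  | nil => simp [wordToIndexFrom]
  | cons b v ih => cases b <;> simp [wordToIndexFrom, ih]

theorem count_false_indexToWord (L : List ℕ) (hL : ∀ a ∈ L, 1 ≤ a) :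
    (indexToWord L).count false + L.length = L.sum := by
  induction L with
  | nil => simp [indexToWord]
  | cons a L ih =>
    have h1 := hL a (by simp)
    have h2 := ih fun b hb => hL b (by simp [hb])
    rw [indexToWord] at h2 ⊢
    simp only [List.flatMap_cons, List.cons_append, List.count_cons, List.count_append,
      List.count_replicate_self, List.length_cons, List.sum_cons]
    simp
    omega

theorem count_true_map_not (L : List Bool) : (L.map not).count true = L.count false := by
  induction L with
  | nil => rfl
  | cons b L ih => cases b <;> simp [ih]

theorem count_true_dualWord {r : ℕ} (k : Fin r → ℕ) (hk : ∀ i, 1 ≤ k i) :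
    (dualWord k).count true + r = ∑ i, k i := by
  have h := count_false_indexToWord (List.ofFn k) (by simpa [List.forall_mem_ofFn_iff] using hk)
  rw [dualWord, count_true_map_not, List.count_reverse]
  simpa [List.sum_ofFn] using h

theorem ofFn_dualIndex {r : ℕ} (k : Fin r → ℕ) :
    List.ofFn (dualIndex k) = wordToIndex (dualWord k) := by
  rw [dualIndex]
  exact List.ofFn_get _

/-- Entries of the dual correspond to letters `true` of its word. The dual word of `k` has `|k| - r`
of them, and the raise adds one. -/
theorem dualDepth_raiseLast {r : ℕ} (hr : 1 ≤ r) (k : Fin r → ℕ) (hk : ∀ i, 1 ≤ k i) :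
    dualDepth (raiseLast k) + r = (∑ i, k i) + 1 := by
  have h : dualDepth (raiseLast k) = (wordToIndex (dualWord (raiseLast k))).length := rfl
  rw [h, dualWord_raiseLast hr k hk, wordToIndex, length_wordToIndexFrom,
    ← count_true_dualWord k hk]
  ring

/-! ### The common integral, its finiteness and the convergence of the series. -/

/-- The integrals of `ξ` (for `δ = 1`) and `η` (for `δ = 0`) up to sign, as Lebesgue integrals. -/
noncomputable def zetaIntegral (δ : ℕ) {r : ℕ} (k : Fin r → ℕ) (q : ℕ) : ℝ≥0∞ :=
  ∫⁻ t in Ioi 0, ENNReal.ofReal (t ^ q / q.factorial) *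
    (ENNReal.ofReal (bernoulliKernel 1 t) * headIntegral δ (dualWord k) t)

theorem zetaIntegral_eq {δ : ℕ} (hδ : δ ≤ 1) {r : ℕ} (hr : 1 ≤ r) (k : Fin r → ℕ)
    (hk : ∀ i, 1 ≤ k i) (q : ℕ) :
    zetaIntegral δ k q =
      ∑ j ∈ Finset.piAntidiag (Finset.univ : Finset (Fin (dualDepth (raiseLast k)))) q,
        (indexBinom (dualIndex (raiseLast k)) j : ℝ≥0∞) *
          ∑' m : gapTuples δ (1 - δ) (dualDepth (raiseLast k)),
            ENNReal.ofReal (zetaTerm (dualIndex (raiseLast k) + j) m) := by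
  rw [zetaIntegral, lintegral_pow_mul_headIntegral, seriesSum_wordSeries hδ,
    ← dualWord_raiseLast hr k hk, ← ofFn_dualIndex, coeff_indexSeries]

theorem lintegral_one_add_pow_mul_exp_neg_ne_top (n : ℕ) :
    ∫⁻ t in Ioi (0 : ℝ), ENNReal.ofReal ((1 + t) ^ n * Real.exp (-t)) ≠ ⊤ := by
  have hint : IntegrableOn (fun t : ℝ => (1 + t) ^ n * Real.exp (-t)) (Ioi 0) := by
    refine integrable_of_isBigO_exp_neg (b := 1 / 2) (by norm_num) (by fun_prop) ?_
    -- With `x = (1 + t)/2` the integrand is `2^n e^{1/2} e^{-t/2} * (x^n e^{-x})`, and the last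
    -- factor is eventually at most 1.
    have h1 := (Real.tendsto_pow_mul_exp_neg_atTop_nhds_zero n).comp
      ((tendsto_atTop_add_const_left atTop (1 : ℝ) tendsto_id).atTop_div_const
        (show (0 : ℝ) < 2 by norm_num))
    refine Asymptotics.IsBigO.of_bound (2 ^ n * Real.exp (1 / 2)) ?_
    filter_upwards [h1.eventually_le_const (show (0 : ℝ) < 1 by norm_num), eventually_ge_atTop 0]
      with t ht ht0
    simp only [Function.comp, id] at ht
    rw [Real.norm_of_nonneg (by positivity), Real.norm_of_nonneg (by positivity)]
    calc (1 + t) ^ n * Real.exp (-t)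
        = 2 ^ n * Real.exp (1 / 2) * Real.exp (-(1 / 2) * t) *
            (((1 + t) / 2) ^ n * Real.exp (-((1 + t) / 2))) := by
          have : Real.exp (-t) = Real.exp (1 / 2) * Real.exp (-(1 / 2) * t) *
              Real.exp (-((1 + t) / 2)) := by
            rw [← Real.exp_add, ← Real.exp_add]; congr 1; ring
          rw [this, div_pow]
          field_simp
      _ ≤ _ := mul_le_of_le_one_right (by positivity) ht
  exact hint.lintegral_lt_top.ne

/-- The zero of the head integral at 0 cancels the pole of the outer kernel. The head integral grows
at most polynomially, so the decay `e^{-t}` of that kernel suffices at infinity, also for `δ = 0`.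
-/
theorem zetaIntegral_ne_top (δ : ℕ) {r : ℕ} (hr : 1 ≤ r) (k : Fin r → ℕ) (q : ℕ) :
    zetaIntegral δ k q ≠ ⊤ := by
  obtain ⟨v, hv⟩ := exists_dualWord_eq_append hr k
  refine ne_top_of_le_ne_top
    (lintegral_one_add_pow_mul_exp_neg_ne_top (q + 1 + v.length)) ?_
  rw [zetaIntegral, hv]
  refine setLIntegral_mono (by fun_prop) fun t ht => ?_
  have ht0 : (0 : ℝ) < t := ht
  refine (mul_le_mul' (ENNReal.ofReal_le_ofReal (q := (1 + t) ^ q) ?_)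
    (mul_le_mul' (ENNReal.ofReal_le_ofReal (bernoulliKernel_le 1 ht0))
      (headIntegral_append_false_le δ v ht0.le))).trans ?_
  · refine (div_le_self (by positivity) (by exact_mod_cast q.factorial_pos)).trans ?_
    gcongr
    linarith
  · rw [← ENNReal.ofReal_mul (by positivity), ← ENNReal.ofReal_mul (by positivity)]
    refine ENNReal.ofReal_le_ofReal (le_of_eq ?_)
    rw [Nat.cast_one, one_mul]
    field_simp
    ring

theorem summable_and_ofReal_tsum {ι : Type*} {f : ι → ℝ} (hf : ∀ i, 0 ≤ f i)
    (h : ∑' i, ENNReal.ofReal (f i) ≠ ⊤) :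
    Summable f ∧ ∑' i, ENNReal.ofReal (f i) = ENNReal.ofReal (∑' i, f i) := by
  have hs : Summable f := by
    simpa only [ENNReal.toReal_ofReal (hf _)] using ENNReal.summable_toReal h
  exact ⟨hs, (ENNReal.ofReal_tsum_of_nonneg hf hs).symm⟩

/-- For `q = 0` the finite integral is the single series with `j = 0`; larger exponents only shrink
its terms. -/
theorem tsum_zetaTerm_ne_top {δ : ℕ} (hδ : δ ≤ 1) {r : ℕ} (hr : 1 ≤ r) (k : Fin r → ℕ)
    (hk : ∀ i, 1 ≤ k i) (j : Fin (dualDepth (raiseLast k)) → ℕ) :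
    ∑' m : gapTuples δ (1 - δ) (dualDepth (raiseLast k)),
      ENNReal.ofReal (zetaTerm (dualIndex (raiseLast k) + j) m) ≠ ⊤ := by
  have h0 := zetaIntegral_ne_top δ hr k 0
  rw [zetaIntegral_eq hδ hr k hk, Finset.piAntidiag_zero, Finset.sum_singleton] at h0
  simp only [indexBinom, Pi.zero_apply, Nat.choose_zero_right, Finset.prod_const_one, Nat.cast_one,
    one_mul, add_zero] at h0
  refine ne_top_of_le_ne_top h0 (ENNReal.tsum_le_tsum fun m => ENNReal.ofReal_le_ofReal ?_)
  have hm := one_le_of_mem_gapTuples m.2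
  have hm' : ∀ i, (1 : ℝ) ≤ m.1 i := fun i => by exact_mod_cast hm i
  rw [zetaTerm, zetaTerm]
  refine one_div_le_one_div_of_le
    (Finset.prod_pos fun i _ => pow_pos (zero_lt_one.trans_le (hm' i)) _) ?_
  refine Finset.prod_le_prod (fun i _ => by positivity) fun i _ => ?_
  exact pow_le_pow_right₀ (hm' i) (Nat.le_add_right _ _)

theorem tsum_gapTuples_one {n : ℕ} (f : (Fin n → ℕ) → ℝ≥0∞) :
    ∑' m : gapTuples 1 (1 - 1) n, f m = ∑' p : StrictTuple n, f p.1 :=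
  (Equiv.subtypeEquivRight mem_gapTuples_one_iff).tsum_eq (fun p : StrictTuple n => f p.1)

theorem tsum_gapTuples_zero {n : ℕ} (f : (Fin n → ℕ) → ℝ≥0∞) :
    ∑' m : gapTuples 0 (1 - 0) n, f m = ∑' p : WeakTuple n, f p.1 :=
  (Equiv.subtypeEquivRight mem_gapTuples_zero_iff).tsum_eq (fun p : WeakTuple n => f p.1)

theorem summable_zetaTerm_strictTuple {r : ℕ} (hr : 1 ≤ r) (k : Fin r → ℕ) (hk : ∀ i, 1 ≤ k i)
    (j : Fin (dualDepth (raiseLast k)) → ℕ) :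
    Summable (fun p : StrictTuple _ => zetaTerm (dualIndex (raiseLast k) + j) p.1) ∧
      ∑' p : StrictTuple _, ENNReal.ofReal (zetaTerm (dualIndex (raiseLast k) + j) p.1) =
        ENNReal.ofReal (multiZeta (dualIndex (raiseLast k) + j)) := by
  refine summable_and_ofReal_tsum (fun p => zetaTerm_nonneg _ _) ?_
  rw [← tsum_gapTuples_one fun m => ENNReal.ofReal (zetaTerm (dualIndex (raiseLast k) + j) m)]
  exact tsum_zetaTerm_ne_top le_rfl hr k hk j

theorem summable_zetaTerm_weakTuple {r : ℕ} (hr : 1 ≤ r) (k : Fin r → ℕ) (hk : ∀ i, 1 ≤ k i)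
    (j : Fin (dualDepth (raiseLast k)) → ℕ) :
    Summable (fun p : WeakTuple _ => zetaTerm (dualIndex (raiseLast k) + j) p.1) ∧
      ∑' p : WeakTuple _, ENNReal.ofReal (zetaTerm (dualIndex (raiseLast k) + j) p.1) =
        ENNReal.ofReal (multiZetaStar (dualIndex (raiseLast k) + j)) := by
  refine summable_and_ofReal_tsum (fun p => zetaTerm_nonneg _ _) ?_
  rw [← tsum_gapTuples_zero fun m => ENNReal.ofReal (zetaTerm (dualIndex (raiseLast k) + j) m)]
  exact tsum_zetaTerm_ne_top zero_le_one hr k hk j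

theorem toReal_zetaIntegral_one {r : ℕ} (hr : 1 ≤ r) (k : Fin r → ℕ) (hk : ∀ i, 1 ≤ k i) (q : ℕ) :
    (zetaIntegral 1 k q).toReal =
      ∑ j ∈ Finset.piAntidiag (Finset.univ : Finset (Fin (dualDepth (raiseLast k)))) q,
        (indexBinom (dualIndex (raiseLast k)) j : ℝ) *
          multiZeta (dualIndex (raiseLast k) + j) := by
  have hnn : ∀ j, 0 ≤ multiZeta (dualIndex (raiseLast k) + j) := fun j =>
    tsum_nonneg fun p => zetaTerm_nonneg _ _
  rw [zetaIntegral_eq le_rfl hr k hk, ENNReal.toReal_sum fun j _ =>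
    ENNReal.mul_ne_top (ENNReal.natCast_ne_top _) (tsum_zetaTerm_ne_top le_rfl hr k hk j)]
  refine Finset.sum_congr rfl fun j _ => ?_
  rw [tsum_gapTuples_one fun m => ENNReal.ofReal (zetaTerm (dualIndex (raiseLast k) + j) m),
    (summable_zetaTerm_strictTuple hr k hk j).2, ENNReal.toReal_mul, ENNReal.toReal_natCast,
    ENNReal.toReal_ofReal (hnn j)]

theorem toReal_zetaIntegral_zero {r : ℕ} (hr : 1 ≤ r) (k : Fin r → ℕ) (hk : ∀ i, 1 ≤ k i) (q : ℕ) :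
    (zetaIntegral 0 k q).toReal =
      ∑ j ∈ Finset.piAntidiag (Finset.univ : Finset (Fin (dualDepth (raiseLast k)))) q,
        (indexBinom (dualIndex (raiseLast k)) j : ℝ) *
          multiZetaStar (dualIndex (raiseLast k) + j) := by
  have hnn : ∀ j, 0 ≤ multiZetaStar (dualIndex (raiseLast k) + j) := fun j =>
    tsum_nonneg fun p => zetaTerm_nonneg _ _
  rw [zetaIntegral_eq zero_le_one hr k hk, ENNReal.toReal_sum fun j _ =>
    ENNReal.mul_ne_top (ENNReal.natCast_ne_top _) (tsum_zetaTerm_ne_top zero_le_one hr k hk j)]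
  refine Finset.sum_congr rfl fun j _ => ?_
  rw [tsum_gapTuples_zero fun m => ENNReal.ofReal (zetaTerm (dualIndex (raiseLast k) + j) m),
    (summable_zetaTerm_weakTuple hr k hk j).2, ENNReal.toReal_mul, ENNReal.toReal_natCast,
    ENNReal.toReal_ofReal (hnn j)]

/-- A function that agrees with a multiple of the integrand of `zetaIntegral` is integrable, and
its integral is the corresponding multiple of `zetaIntegral`. -/
theorem integrableOn_and_integral_eq {δ : ℕ} {r : ℕ} (hr : 1 ≤ r) (k : Fin r → ℕ) (q : ℕ)
    {f : ℝ → ℂ} {c : ℂ}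
    (hf : ∀ t : ℝ, 0 < t → f t = c *
      ((t ^ q * (bernoulliKernel 1 t * (headIntegral δ (dualWord k) t).toReal) : ℝ) : ℂ)) :
    IntegrableOn f (Ioi 0) ∧
      ∫ t in Ioi (0 : ℝ), f t = c * (q.factorial * (zetaIntegral δ k q).toReal : ℝ) := by
  set φ : ℝ → ℝ≥0∞ := fun t => ENNReal.ofReal (t ^ q / q.factorial) *
    (ENNReal.ofReal (bernoulliKernel 1 t) * headIntegral δ (dualWord k) t) with hφ
  have hφm : Measurable φ := by fun_prop
  have hfin : ∫⁻ t in Ioi 0, φ t ≠ ⊤ := zetaIntegral_ne_top δ hr k q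
  have hfac : (q.factorial : ℝ) ≠ 0 := by positivity
  have hcongr : ∀ t ∈ Ioi (0 : ℝ), f t = c * ((q.factorial * (φ t).toReal : ℝ) : ℂ) := by
    intro t ht
    have ht0 : (0 : ℝ) < t := ht
    rw [hf t ht0, hφ]
    simp only [ENNReal.toReal_mul]
    rw [ENNReal.toReal_ofReal (by positivity), ENNReal.toReal_ofReal (bernoulliKernel_pos 1 ht0).le]
    congr 2
    field_simp
  have hint : IntegrableOn (fun t => (φ t).toReal) (Ioi 0) :=
    integrable_toReal_of_lintegral_ne_top hφm.aemeasurable hfin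
  refine ⟨?_, ?_⟩
  · rw [integrableOn_congr_fun hcongr measurableSet_Ioi]
    exact ((hint.const_mul _).ofReal).const_mul c
  · rw [setIntegral_congr_fun measurableSet_Ioi hcongr, integral_const_mul, integral_complex_ofReal,
      integral_const_mul, integral_toReal hφm.aemeasurable (ae_lt_top hφm hfin)]
    rfl

/-! ### The values of ξ and η at positive integers. -/

theorem xiIntegrand_integral {r : ℕ} (hr : 1 ≤ r) (k : Fin r → ℕ) (hk : ∀ i, 1 ≤ k i) (q : ℕ) :
    IntegrableOn (xiIntegrand k ((q + 1 : ℕ) : ℂ)) (Ioi 0) ∧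
      ∫ t in Ioi (0 : ℝ), xiIntegrand k ((q + 1 : ℕ) : ℂ) t =
        1 * (q.factorial * (zetaIntegral 1 k q).toReal : ℝ) := by
  refine integrableOn_and_integral_eq hr k q fun t ht => ?_
  have h := (multiPolylog_eq_headIntegral (Or.inl ⟨rfl, rfl⟩) k hk ht.le).2
  simp only [Complex.ofReal_one, one_mul, one_pow] at h
  have hker : ((bernoulliKernel 1 t : ℝ) : ℂ) = 1 / (Complex.exp t - 1) := by
    have h1 : Real.exp t - 1 ≠ 0 := by
      have := Real.add_one_lt_exp ht.ne'
      exact ne_of_gt (by linarith)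
    have h2 := (one_sub_exp_neg_pos ht).ne'
    have h3 : Real.exp (-t) * Real.exp t = 1 := by rw [← Real.exp_add]; simp
    have h4 : bernoulliKernel 1 t = 1 / (Real.exp t - 1) := by
      rw [bernoulliKernel, Nat.cast_one, one_mul, div_eq_div_iff h2 h1]
      linear_combination h3
    rw [h4]
    push_cast
    rfl
  rw [xiIntegrand, h, Nat.cast_add, Nat.cast_one, _root_.add_sub_cancel_right,
    Complex.cpow_natCast]
  push_cast
  rw [hker]
  ring

/-- The polylogarithm carries the sign `(-1)^r`, and `1/(1 - e^t)` is minus the kernel; together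
they give `(-1)^(r - 1)`. -/
theorem etaIntegrand_integral {r : ℕ} (hr : 1 ≤ r) (k : Fin r → ℕ) (hk : ∀ i, 1 ≤ k i) (q : ℕ) :
    IntegrableOn (etaIntegrand k ((q + 1 : ℕ) : ℂ)) (Ioi 0) ∧
      ∫ t in Ioi (0 : ℝ), etaIntegrand k ((q + 1 : ℕ) : ℂ) t =
        (-1) ^ (r - 1) * (q.factorial * (zetaIntegral 0 k q).toReal : ℝ) := by
  refine integrableOn_and_integral_eq hr k q fun t ht => ?_
  have h := (multiPolylog_eq_headIntegral (Or.inr ⟨rfl, rfl⟩) k hk ht.le).2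
  simp only [Complex.ofReal_neg, Complex.ofReal_one, neg_mul, one_mul, neg_neg] at h
  have hker : ((bernoulliKernel 1 t : ℝ) : ℂ) = -1 / (1 - Complex.exp t) := by
    have h1 : 1 - Real.exp t ≠ 0 := by
      have := Real.add_one_lt_exp ht.ne'
      exact ne_of_lt (by linarith)
    have h2 := (one_sub_exp_neg_pos ht).ne'
    have h3 : Real.exp (-t) * Real.exp t = 1 := by rw [← Real.exp_add]; simp
    have h4 : bernoulliKernel 1 t = -1 / (1 - Real.exp t) := by
      rw [bernoulliKernel, Nat.cast_one, one_mul, div_eq_div_iff h2 h1]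
      linear_combination -h3
    rw [h4]
    push_cast
    rfl
  obtain ⟨s, rfl⟩ : ∃ s, r = s + 1 := ⟨r - 1, by omega⟩
  rw [etaIntegrand, h, Nat.cast_add, Nat.cast_one, _root_.add_sub_cancel_right,
    Complex.cpow_natCast, Nat.add_sub_cancel, pow_succ]
  push_cast
  rw [hker]
  ring

theorem arakawaKanekoXi_natCast {r : ℕ} (hr : 1 ≤ r) (k : Fin r → ℕ) (hk : ∀ i, 1 ≤ k i) (q : ℕ) :
    arakawaKanekoXi k ((q + 1 : ℕ) : ℂ) = ((zetaIntegral 1 k q).toReal : ℝ) := by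
  have hfac : (q.factorial : ℂ) ≠ 0 := by exact_mod_cast q.factorial_ne_zero
  rw [arakawaKanekoXi, (xiIntegrand_integral hr k hk q).2, Nat.cast_add, Nat.cast_one,
    Complex.Gamma_nat_eq_factorial]
  push_cast
  field_simp

theorem kanekoTsumuraEta_natCast {r : ℕ} (hr : 1 ≤ r) (k : Fin r → ℕ) (hk : ∀ i, 1 ≤ k i) (q : ℕ) :
    kanekoTsumuraEta k ((q + 1 : ℕ) : ℂ) =
      (((-1) ^ (r - 1) * (zetaIntegral 0 k q).toReal : ℝ) : ℂ) := by
  have hfac : (q.factorial : ℂ) ≠ 0 := by exact_mod_cast q.factorial_ne_zero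
  rw [kanekoTsumuraEta, (etaIntegrand_integral hr k hk q).2, Nat.cast_add, Nat.cast_one,
    Complex.Gamma_nat_eq_factorial]
  push_cast
  field_simp

/-! ### Duality, by termwise integration. -/

/-- With `x = 1 - e^{-t}` this is the integral of `x^{n-1}` over `(0, 1)`. -/
theorem lintegral_bernoulliKernel_mul_pow {n : ℕ} (hn : 1 ≤ n) :
    ∫⁻ t in Ioi (0 : ℝ), ENNReal.ofReal (bernoulliKernel 1 t * (1 - Real.exp (-t)) ^ n) =
      ENNReal.ofReal (1 / n) := by
  obtain ⟨n, rfl⟩ : ∃ s, n = s + 1 := ⟨n - 1, by omega⟩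
  have hd : ∀ t : ℝ, HasDerivAt (fun t : ℝ => (1 - Real.exp (-t)) ^ (n + 1) / (n + 1 : ℕ))
      ((1 - Real.exp (-t)) ^ n * Real.exp (-t)) t := by
    intro t
    have h1 : HasDerivAt (fun t : ℝ => 1 - Real.exp (-t)) (-(Real.exp (-t) * -1)) t :=
      (((hasDerivAt_id t).neg).exp).const_sub 1
    convert! (h1.pow (n + 1)).div_const ((n + 1 : ℕ) : ℝ) using 1
    have : ((n + 1 : ℕ) : ℝ) ≠ 0 := by positivity
    simp only [Nat.add_sub_cancel]
    field_simp
  have hnn : ∀ t ∈ Ioi (0 : ℝ), 0 ≤ (1 - Real.exp (-t)) ^ n * Real.exp (-t) := fun t ht =>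
    mul_nonneg (pow_nonneg (one_sub_exp_neg_pos ht).le _) (Real.exp_pos _).le
  have hlim : Tendsto (fun t : ℝ => (1 - Real.exp (-t)) ^ (n + 1) / (n + 1 : ℕ)) atTop
      (𝓝 (1 / (n + 1 : ℕ))) := by
    have h1 : Tendsto (fun t : ℝ => 1 - Real.exp (-t)) atTop (𝓝 (1 - 0)) :=
      (Real.tendsto_exp_neg_atTop_nhds_zero).const_sub 1
    simpa using (h1.pow (n + 1)).div_const ((n + 1 : ℕ) : ℝ)
  have hint := integrableOn_Ioi_deriv_of_nonneg (hd 0).continuousAt.continuousWithinAt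
    (fun t _ => hd t) hnn hlim
  have hval := integral_Ioi_of_hasDerivAt_of_nonneg (hd 0).continuousAt.continuousWithinAt
    (fun t _ => hd t) hnn hlim
  have hae : 0 ≤ᵐ[volume.restrict (Ioi 0)] fun t => (1 - Real.exp (-t)) ^ n * Real.exp (-t) := by
    filter_upwards [ae_restrict_mem measurableSet_Ioi] with t ht using hnn t ht
  have h0 : (1 : ℝ) / (n + 1 : ℕ) =
      1 / (n + 1 : ℕ) - (1 - Real.exp (-0)) ^ (n + 1) / (n + 1 : ℕ) := by simp
  rw [h0, ← hval, ofReal_integral_eq_lintegral_ofReal hint hae]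
  refine setLIntegral_congr_fun measurableSet_Ioi fun t ht => ?_
  have := (one_sub_exp_neg_pos ht).ne'
  simp only [bernoulliKernel, Nat.cast_one, one_mul]
  congr 1
  field_simp
  ring

/-- For `δ = 1` the argument `1 - e^{-t}` stays in the unit disc, so the power series is available
on the whole range of integration. For `δ = 0` the argument `1 - e^t` leaves the disc. -/
theorem headIntegral_one_eq_tsum {r : ℕ} (k : Fin r → ℕ) (hk : ∀ i, 1 ≤ k i) {t : ℝ} (ht : 0 < t) :
    headIntegral 1 (dualWord k) t = ∑' m : StrictTuple r,
      ENNReal.ofReal ((1 - Real.exp (-t)) ^ Finset.univ.sup m.1 * zetaTerm k m.1) := by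
  obtain ⟨hfin, h⟩ := multiPolylog_eq_headIntegral (Or.inl ⟨rfl, rfl⟩) k hk ht.le
  have hz := one_sub_exp_neg_pos ht
  have hz1 : 1 - Real.exp (-t) < 1 := by
    have := Real.exp_pos (-t)
    linarith
  have hcast : (1 : ℂ) - Complex.exp (-((1 : ℝ) * t)) = ((1 - Real.exp (-t) : ℝ) : ℂ) := by
    push_cast
    rw [one_mul]
  have hs := multiPolylog_hasSum k (z := ((1 - Real.exp (-t) : ℝ) : ℂ))
    (by rwa [Complex.norm_real, Real.norm_of_nonneg hz.le])
  rw [← hcast, h, hcast, Complex.ofReal_one, one_pow, one_mul] at hs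
  have hterm : polylogTerm k ((1 - Real.exp (-t) : ℝ) : ℂ) = fun m : StrictTuple r =>
      (((1 - Real.exp (-t)) ^ Finset.univ.sup m.1 * zetaTerm k m.1 : ℝ) : ℂ) := by
    funext m
    rw [polylogTerm, zetaTerm]
    push_cast
    ring
  rw [hterm, Complex.hasSum_ofReal] at hs
  rw [← ENNReal.ofReal_tsum_of_nonneg (fun m => mul_nonneg (pow_nonneg hz.le _)
    (zetaTerm_nonneg _ _)) hs.summable, hs.tsum_eq, ENNReal.ofReal_toReal hfin]

/-- Termwise integration of the series of the multiple polylogarithm. -/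
theorem zetaIntegral_one_zero {r : ℕ} (hr : 1 ≤ r) (k : Fin r → ℕ) (hk : ∀ i, 1 ≤ k i) :
    zetaIntegral 1 k 0 = ∑' m : StrictTuple r, ENNReal.ofReal (zetaTerm (raiseLast k) m.1) := by
  have h : ∀ t ∈ Ioi (0 : ℝ), ENNReal.ofReal (t ^ 0 / Nat.factorial 0) *
      (ENNReal.ofReal (bernoulliKernel 1 t) * headIntegral 1 (dualWord k) t) =
      ∑' m : StrictTuple r, ENNReal.ofReal (zetaTerm k m.1) *
        ENNReal.ofReal (bernoulliKernel 1 t * (1 - Real.exp (-t)) ^ Finset.univ.sup m.1) := by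
    intro t ht
    rw [headIntegral_one_eq_tsum k hk ht, ← ENNReal.tsum_mul_left, ← ENNReal.tsum_mul_left]
    refine tsum_congr fun m => ?_
    have h1 := (bernoulliKernel_pos 1 ht).le
    rw [← ENNReal.ofReal_mul h1, ← ENNReal.ofReal_mul (zetaTerm_nonneg _ _)]
    simp only [pow_zero, Nat.factorial_zero, Nat.cast_one, div_one, ENNReal.ofReal_one, one_mul]
    congr 1
    ring
  rw [zetaIntegral, setLIntegral_congr_fun measurableSet_Ioi h, lintegral_tsum (by fun_prop)]
  refine tsum_congr fun m => ?_
  obtain ⟨r, rfl⟩ : ∃ s, r = s + 1 := ⟨r - 1, by omega⟩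
  have hm := m.2.2 (Fin.last r)
  -- The integral of the `m`-th term contributes `1/m_r`, which raises the last exponent by one.
  rw [lintegral_const_mul _ (by fun_prop), sup_strictTuple_eq_last,
    lintegral_bernoulliKernel_mul_pow hm, ← ENNReal.ofReal_mul (zetaTerm_nonneg _ _)]
  obtain ⟨k', a, rfl⟩ := exists_eq_snoc k
  rw [raiseLast_snoc, zetaTerm, zetaTerm, Fin.prod_univ_castSucc, Fin.prod_univ_castSucc]
  simp only [Fin.snoc_castSucc, Fin.snoc_last]
  congr 1
  rw [pow_succ, div_mul_div_comm, one_mul, mul_assoc]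

end IteratedIntegrals

theorem theorem2p3 {r : ℕ} (hr : 1 ≤ r) (k : Fin r → ℕ) (hk : ∀ i, 1 ≤ k i)
    (m : ℕ) (hm : 1 ≤ m) :
    -- the dual of `k₊` has depth `n = |k| + 1 - r`
    dualDepth (raiseLast k) + r = (∑ i, k i) + 1 ∧
    -- the integrals and the series in the formulas converge absolutely
    MeasureTheory.IntegrableOn (xiIntegrand k m) (Set.Ioi 0) ∧
    MeasureTheory.IntegrableOn (etaIntegrand k m) (Set.Ioi 0) ∧
    (∀ j : Fin (dualDepth (raiseLast k)) → ℕ,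
      Summable (fun p : StrictTuple _ => zetaTerm (dualIndex (raiseLast k) + j) p.1) ∧
      Summable (fun p : WeakTuple _ => zetaTerm (dualIndex (raiseLast k) + j) p.1)) ∧
    Summable (fun p : StrictTuple r => zetaTerm (raiseLast k) p.1) ∧
    -- the values at `m`
    arakawaKanekoXi k m =
      ((∑ j ∈ Finset.piAntidiag (Finset.univ : Finset (Fin (dualDepth (raiseLast k)))) (m - 1),
        (indexBinom (dualIndex (raiseLast k)) j : ℝ) *
          multiZeta (dualIndex (raiseLast k) + j) : ℝ) : ℂ) ∧
    kanekoTsumuraEta k m =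
      (((-1) ^ (r - 1) *
        ∑ j ∈ Finset.piAntidiag (Finset.univ : Finset (Fin (dualDepth (raiseLast k)))) (m - 1),
          (indexBinom (dualIndex (raiseLast k)) j : ℝ) *
            multiZetaStar (dualIndex (raiseLast k) + j) : ℝ) : ℂ) ∧
    -- the values at `1`
    arakawaKanekoXi k 1 = (multiZeta (dualIndex (raiseLast k)) : ℂ) ∧
    multiZeta (dualIndex (raiseLast k)) = multiZeta (raiseLast k) ∧
    kanekoTsumuraEta k 1 = (((-1) ^ (r - 1) * multiZetaStar (dualIndex (raiseLast k)) : ℝ) : ℂ) := by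
  obtain ⟨q, rfl⟩ : ∃ q, m = q + 1 := ⟨m - 1, by omega⟩
  have hsum : ∑' p : StrictTuple r, ENNReal.ofReal (zetaTerm (raiseLast k) p.1) ≠ ⊤ := by
    rw [← zetaIntegral_one_zero hr k hk]
    exact zetaIntegral_ne_top 1 hr k 0
  have hduality := summable_and_ofReal_tsum
    (fun p : StrictTuple r => zetaTerm_nonneg (raiseLast k) p.1) hsum
  have hxi := arakawaKanekoXi_natCast hr k hk 0
  have heta := kanekoTsumuraEta_natCast hr k hk 0
  have hone := toReal_zetaIntegral_one hr k hk 0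
  have hzero := toReal_zetaIntegral_zero hr k hk 0
  -- At `m = 1` only `j = 0` occurs, with coefficient 1.
  simp only [Finset.piAntidiag_zero, Finset.sum_singleton, indexBinom, Pi.zero_apply,
    Nat.choose_zero_right, Finset.prod_const_one, Nat.cast_one, one_mul, add_zero] at hone hzero
  rw [zero_add, Nat.cast_one] at hxi heta
  refine ⟨dualDepth_raiseLast hr k hk, (xiIntegrand_integral hr k hk q).1,
    (etaIntegrand_integral hr k hk q).1, fun j => ⟨(summable_zetaTerm_strictTuple hr k hk j).1,
      (summable_zetaTerm_weakTuple hr k hk j).1⟩, hduality.1, ?_, ?_, ?_, ?_, ?_⟩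
  · rw [arakawaKanekoXi_natCast hr k hk, toReal_zetaIntegral_one hr k hk, Nat.add_sub_cancel]
  · rw [kanekoTsumuraEta_natCast hr k hk, toReal_zetaIntegral_zero hr k hk, Nat.add_sub_cancel]
  · rw [hxi, hone]
  -- Both zeta values are evaluations of the same integral `zetaIntegral 1 k 0`.
  · rw [← hone, zetaIntegral_one_zero hr k hk, hduality.2,
      ENNReal.toReal_ofReal (tsum_nonneg fun p => zetaTerm_nonneg _ _)]
    rfl
  · rw [heta, hzero]
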